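/- Let $N\ge 0$ and let $\omega\colon[0,\infty)\to[0,\infty)$ be a non-quasianalytic weight function, i.e. a continuous non-decreasing function such that: ($\alpha$) there is $K\ge1$ with $\omega(2t)\le K(1+\omega(t))$ for all $t\ge0$; ($\beta$) $\int_1^\infty\frac{\omega(t)}{1+t^2}\,dt<\infty$; ($\gamma$) there are $a\in\mathbb R$, $b>0$ with $\omega(t)\ge a+b\log(1+t)$ for all $t\ge0$; ($\delta$) $t\mapsto\omega(e^t)$ is convex on $\mathbb R$. Put $\varphi^*_\omega(s)=\sup_{t\ge0}\{st-\omega(e^t)\}\in(-\infty,\infty]$ for $s\ge0$, $\omega(x)=\omega(|x|)$ for $x\in\mathbb R^N$, and $\exp(-\infty)=0$. For integers $m,n\ge1$ let $\mathcal O^m_{n,\omega}(\mathbb R^N)$ be the space of all $f\in C^\infty(\mathbb R^N)$ (complex-valued) with $$r_{m,n}(f)=\sup_{\alpha\in\mathbb N_0^N}\sup_{x\in\mathbb R^N}|\partial^\alpha f(x)|\exp\Big(-n\omega(x)-m\varphi^*_\omega\big(\tfrac{|\alpha|}m\big)\Big)<\infty ,$$ normed by $r_{m,n}$, and give $\bigcup_{n\ge1}\mathcal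 O^m_{n,\omega}(\mathbb R^N)$ the inductive topology, i.e. the finest locally convex topology for which all inclusions of the spaces $(\mathcal O^m_{n,\omega}(\mathbb R^N),r_{m,n})$ are continuous. Let $\mathcal S_\omega(\mathbb R^N)$ be the set of all $g\in L^1(\mathbb R^N)$ such that $g,\hat g\in C^\infty(\mathbb R^N)$ and $\exp(\lambda\omega)\partial^\alpha g$ and $\exp(\lambda\omega)\partial^\alpha\hat g$ are bounded for all $\lambda>0$ and $\alpha\in\mathbb N_0^N$, where $\hat g(\xi)=\int_{\mathbb R^N} g(x)e^{-ix\cdot\xi}\,dx$. Let $\mathcal O^m_{s_\omega}(\mathbb R^N)$ be the space of all $f\in C^\infty(\mathbb R^N)$ with $$q_{m,g}(f)=\sup_{\alpha\in\mathbb N_0^N}\sup_{x\in\mathbb R^N}|g(x)||\partial^\alpha f(x)|\exp\Big(-m\varphi^*_\omega\big(\tfrac{|\alpha|}m\big)\Big)<\infty\quad\text{for all }g\in\mathcal S_\omega(\mathbb R^N),$$ with the locally convex topology $\tau_m$ generated by the seminorms $q_{m,g}$, $g\in\mathcal S_\omega(\mathbb R^N)$. **Proposition.** For every $m\ge1$ the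 following hold. 1. The spaces $(\mathcal O^m_{n,\omega}(\mathbb R^N),r_{m,n})$, $n\ge1$, are normed spaces with continuous inclusions $\mathcal O^m_{n,\omega}(\mathbb R^N)\hookrightarrow\mathcal O^m_{n',\omega}(\mathbb R^N)$ for $n\le n'$, and the inductive topology on $\bigcup_n\mathcal O^m_{n,\omega}(\mathbb R^N)$ is Hausdorff. If $\varphi^*_\omega$ is finite on $[0,\infty)$, the spaces $(\mathcal O^m_{n,\omega}(\mathbb R^N),r_{m,n})$ are Banach spaces, so that $\bigcup_n\mathcal O^m_{n,\omega}(\mathbb R^N)$ is an (LB)-space. 2. The inductive limit $\bigcup_n\mathcal O^m_{n,\omega}(\mathbb R^N)$ is regular: every bounded subset of it is contained and bounded in $(\mathcal O^m_{n,\omega}(\mathbb R^N),r_{m,n})$ for some $n$. 3. $\bigcup_n\mathcal O^m_{n,\omega}(\mathbb R^N)$ is the bornological space associated with $(\mathcal O^m_{s_\omega}(\mathbb R^N),\tau_m)$: the two spaces consist of the same functions, and the inductive topology is the finest locally convex topology in which every $\tau_m$-bounded set is bounded. -/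

import Mathlib

noncomputable section

namespace OmegaMult

open scoped ENNReal NNReal Topology

/-! ### Weight functions and the Young conjugate -/

/-- Non-quasianalytic weight functions `ω : [0,∞) → [0,∞)` ("increasing" is read as
non-decreasing). -/
structure IsWeight (ω : ℝ≥0 → ℝ≥0) : Prop where
  continuous : Continuous ω
  mono : Monotone ω
  alpha : ∃ K : ℝ, 1 ≤ K ∧ ∀ t : ℝ≥0, (ω (2 * t) : ℝ) ≤ K * (1 + ω t)
  beta : MeasureTheory.IntegrableOn (fun t : ℝ => (ω t.toNNReal : ℝ) / (1 + t ^ 2)) (Set.Ioi 1)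
  gamma : ∃ a b : ℝ, 0 < b ∧ ∀ t : ℝ≥0, a + b * Real.log (1 + t) ≤ ω t
  delta : ConvexOn ℝ Set.univ (fun t : ℝ => (ω (Real.exp t).toNNReal : ℝ))

/-- The Young conjugate `φ*(s) = sup_{t ≥ 0} (s t - ω (exp t))`, with values in `[-∞, ∞]`. -/
def youngConj (ω : ℝ≥0 → ℝ≥0) (s : ℝ) : EReal :=
  ⨆ t : ℝ≥0, ((s * t - ω (Real.exp t).toNNReal : ℝ) : EReal)

/-- The factor `exp (-m φ*(k / m))`, equal to `0` where `φ*(k / m) = ∞`. -/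
def derivFactor (ω : ℝ≥0 → ℝ≥0) (m : ℕ+) (k : ℕ) : ℝ≥0∞ :=
  EReal.exp (-(((m : ℕ) : ℝ) : EReal) * youngConj ω ((k : ℝ) / ((m : ℕ) : ℝ)))

/-! ### Partial derivatives -/

variable {N : ℕ}

/-- The partial derivative `∂ f / ∂ x_i`. -/
def pderiv (i : Fin N) (f : EuclideanSpace ℝ (Fin N) → ℂ) : EuclideanSpace ℝ (Fin N) → ℂ :=
  fun x => fderiv ℝ f x (EuclideanSpace.single i 1)

/-- `∂^α f = ∂_1^{α_1} ⋯ ∂_N^{α_N} f`. -/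
def mderiv (α : Fin N → ℕ) (f : EuclideanSpace ℝ (Fin N) → ℂ) : EuclideanSpace ℝ (Fin N) → ℂ :=
  (List.finRange N).foldr (fun i h => (pderiv i)^[α i] h) f

/-- The length `|α|` of a multi-index. -/
def mlen (α : Fin N → ℕ) : ℕ := ∑ i, α i

/-- An operator preserving smoothness that is linear on smooth functions. -/
structure SmoothLin (D : (EuclideanSpace ℝ (Fin N) → ℂ) → EuclideanSpace ℝ (Fin N) → ℂ) :
    Prop where
  smooth : ∀ f, ContDiff ℝ (⊤ : ℕ∞) f → ContDiff ℝ (⊤ : ℕ∞) (D f)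
  add : ∀ f g, ContDiff ℝ (⊤ : ℕ∞) f → ContDiff ℝ (⊤ : ℕ∞) g → D (f + g) = D f + D g
  smul : ∀ (c : ℂ) f, ContDiff ℝ (⊤ : ℕ∞) f → D (c • f) = c • D f

theorem SmoothLin.id : SmoothLin (N := N) (fun f => f) :=
  ⟨fun _ h => h, fun _ _ _ _ => rfl, fun _ _ _ => rfl⟩

theorem SmoothLin.comp {D D' : (EuclideanSpace ℝ (Fin N) → ℂ) → EuclideanSpace ℝ (Fin N) → ℂ}
    (h : SmoothLin D) (h' : SmoothLin D') : SmoothLin (fun f => D (D' f)) where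
  smooth f hf := h.smooth _ (h'.smooth f hf)
  add f g hf hg := by rw [h'.add f g hf hg, h.add _ _ (h'.smooth f hf) (h'.smooth g hg)]
  smul c f hf := by rw [h'.smul c f hf, h.smul c _ (h'.smooth f hf)]

theorem SmoothLin.iterate
    {D : (EuclideanSpace ℝ (Fin N) → ℂ) → EuclideanSpace ℝ (Fin N) → ℂ}
    (h : SmoothLin D) (k : ℕ) : SmoothLin (fun f => D^[k] f) := by
  induction k with
  | zero => exact SmoothLin.id
  | succ k ih =>
    simp only [Function.iterate_succ_apply']
    exact h.comp ih

theorem smoothLin_pderiv (i : Fin N) : SmoothLin (pderiv i) where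
  smooth f hf := (hf.fderiv_right (m := ((⊤ : ℕ∞) : WithTop ℕ∞)) (by simp)).clm_apply contDiff_const
  add f g hf hg := by
    funext x
    have h1 : DifferentiableAt ℝ f x := (hf.differentiable (by simp)) x
    have h2 : DifferentiableAt ℝ g x := (hg.differentiable (by simp)) x
    simp [pderiv, fderiv_add h1 h2]
  smul c f hf := by
    funext x
    have h1 : DifferentiableAt ℝ f x := (hf.differentiable (by simp)) x
    simp [pderiv, fderiv_const_smul h1 c]

theorem smoothLin_mderiv (α : Fin N → ℕ) : SmoothLin (mderiv α) := by
  unfold mderiv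
  induction List.finRange N with
  | nil => exact SmoothLin.id
  | cons i l ih =>
    simp only [List.foldr_cons]
    exact ((smoothLin_pderiv i).iterate (α i)).comp ih

/-! ### Weighted suprema over all derivatives -/

/-- `sup_α sup_x |∂^α f(x)| w(α, x)`, in `[0, ∞]`. -/
def wsup (w : (Fin N → ℕ) → EuclideanSpace ℝ (Fin N) → ℝ≥0∞)
    (f : EuclideanSpace ℝ (Fin N) → ℂ) : ℝ≥0∞ :=
  ⨆ (α : Fin N → ℕ) (x : EuclideanSpace ℝ (Fin N)), ‖mderiv α f x‖ₑ * w α x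

theorem wsup_add_le (w : (Fin N → ℕ) → EuclideanSpace ℝ (Fin N) → ℝ≥0∞)
    {f g : EuclideanSpace ℝ (Fin N) → ℂ} (hf : ContDiff ℝ (⊤ : ℕ∞) f) (hg : ContDiff ℝ (⊤ : ℕ∞) g) :
    wsup w (f + g) ≤ wsup w f + wsup w g := by
  refine iSup₂_le fun α x => ?_
  rw [(smoothLin_mderiv α).add f g hf hg, Pi.add_apply]
  calc ‖mderiv α f x + mderiv α g x‖ₑ * w α x
      ≤ (‖mderiv α f x‖ₑ + ‖mderiv α g x‖ₑ) * w α x := by gcongr; exact enorm_add_le _ _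
    _ = ‖mderiv α f x‖ₑ * w α x + ‖mderiv α g x‖ₑ * w α x := add_mul _ _ _
    _ ≤ wsup w f + wsup w g :=
        add_le_add (le_iSup₂ (f := fun α x => ‖mderiv α f x‖ₑ * w α x) α x)
          (le_iSup₂ (f := fun α x => ‖mderiv α g x‖ₑ * w α x) α x)

theorem wsup_smul (w : (Fin N → ℕ) → EuclideanSpace ℝ (Fin N) → ℝ≥0∞) (c : ℂ)
    {f : EuclideanSpace ℝ (Fin N) → ℂ} (hf : ContDiff ℝ (⊤ : ℕ∞) f) :
    wsup w (c • f) = ‖c‖ₑ * wsup w f := by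
  unfold wsup
  simp only [ENNReal.mul_iSup]
  refine iSup_congr fun α => iSup_congr fun x => ?_
  rw [(smoothLin_mderiv α).smul c f hf, Pi.smul_apply, enorm_smul, mul_assoc]

/-- The smooth functions with finite weighted supremum for every weight of a family. -/
def finiteSub {ι : Type*} (w : ι → (Fin N → ℕ) → EuclideanSpace ℝ (Fin N) → ℝ≥0∞) :
    Submodule ℂ (EuclideanSpace ℝ (Fin N) → ℂ) where
  carrier := {f | ContDiff ℝ (⊤ : ℕ∞) f ∧ ∀ i, wsup (w i) f < ∞}
  add_mem' {f g} hf hg := ⟨hf.1.add hg.1, fun i =>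
    (wsup_add_le (w i) hf.1 hg.1).trans_lt (ENNReal.add_lt_top.2 ⟨hf.2 i, hg.2 i⟩)⟩
  zero_mem' := ⟨contDiff_const, fun i => by
    have h := wsup_smul (w i) 0 (f := (0 : EuclideanSpace ℝ (Fin N) → ℂ)) contDiff_const
    rw [zero_smul, enorm_zero, zero_mul] at h
    simp [h]⟩
  smul_mem' c f hf := ⟨hf.1.const_smul c, fun i => by
    rw [wsup_smul (w i) c hf.1]
    exact ENNReal.mul_lt_top (by simp) (hf.2 i)⟩

/-- The weighted supremum as a real-valued seminorm on the space where it is finite. -/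
def finiteSeminorm {ι : Type*} (w : ι → (Fin N → ℕ) → EuclideanSpace ℝ (Fin N) → ℝ≥0∞)
    (i : ι) : Seminorm ℂ (finiteSub w) :=
  Seminorm.of (fun f => (wsup (w i) f.1).toReal)
    (fun f g => by
      rw [← ENNReal.toReal_add (f.2.2 i).ne (g.2.2 i).ne]
      exact ENNReal.toReal_mono (ENNReal.add_lt_top.2 ⟨f.2.2 i, g.2.2 i⟩).ne
        (wsup_add_le (w i) f.2.1 g.2.1))
    (fun c f => by
      change (wsup (w i) (c • f.1)).toReal = _
      rw [wsup_smul (w i) c f.2.1, ENNReal.toReal_mul, toReal_enorm])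

/-! ### The normed steps `O^m_{n,ω}` -/

/-- The weight `exp (-n ω(|x|) - m φ*(|α| / m))` defining `r_{m,n}`. -/
def stepWeight (ω : ℝ≥0 → ℝ≥0) (m n : ℕ+) (α : Fin N → ℕ) (x : EuclideanSpace ℝ (Fin N)) :
    ℝ≥0∞ :=
  ENNReal.ofReal (Real.exp (-((n : ℕ) : ℝ) * ω ‖x‖₊)) * derivFactor ω m (mlen α)

/-- `O^m_{n,ω}` as a space of functions: smooth `f` with `r_{m,n}(f) < ∞`. -/
def stepSub (N : ℕ) (ω : ℝ≥0 → ℝ≥0) (m n : ℕ+) :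
    Submodule ℂ (EuclideanSpace ℝ (Fin N) → ℂ) :=
  finiteSub (fun _ : Unit => stepWeight ω m n)

/-- The space `O^m_{n,ω}(ℝ^N)`, to be equipped with the norm `r_{m,n}`. -/
def Step (N : ℕ) (ω : ℝ≥0 → ℝ≥0) (m n : ℕ+) : Type := stepSub N ω m n

instance (ω : ℝ≥0 → ℝ≥0) (m n : ℕ+) : AddCommGroup (Step N ω m n) :=
  inferInstanceAs (AddCommGroup (stepSub N ω m n))

instance (ω : ℝ≥0 → ℝ≥0) (m n : ℕ+) : Module ℂ (Step N ω m n) :=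
  inferInstanceAs (Module ℂ (stepSub N ω m n))

/-- `r_{m,n}`. -/
def stepNorm (N : ℕ) (ω : ℝ≥0 → ℝ≥0) (m n : ℕ+) : Seminorm ℂ (Step N ω m n) :=
  finiteSeminorm (fun _ : Unit => stepWeight ω m n) ()

instance (ω : ℝ≥0 → ℝ≥0) (m n : ℕ+) : SeminormedAddCommGroup (Step N ω m n) :=
  (stepNorm N ω m n).toAddGroupSeminorm.toSeminormedAddCommGroup

instance (ω : ℝ≥0 → ℝ≥0) (m n : ℕ+) : NormedSpace ℂ (Step N ω m n) where
  norm_smul_le c f := ((stepNorm N ω m n).smul' c f).le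

/-! ### The inductive limit `⋃_n O^m_{n,ω}` -/

theorem stepSub_mono (ω : ℝ≥0 → ℝ≥0) (m : ℕ+) {n n' : ℕ+} (h : n ≤ n') :
    stepSub N ω m n ≤ stepSub N ω m n' := by
  rintro f ⟨hf, hr⟩
  refine ⟨hf, fun i => lt_of_le_of_lt (iSup₂_mono fun α x => ?_) (hr i)⟩
  have : ((n : ℕ) : ℝ) ≤ ((n' : ℕ) : ℝ) := by exact_mod_cast h
  change ‖mderiv α f x‖ₑ * stepWeight ω m n' α x ≤ ‖mderiv α f x‖ₑ * stepWeight ω m n α x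
  unfold stepWeight
  gcongr

/-- The union `⋃_{n ≥ 1} O^m_{n,ω}`. -/
def unionSub (N : ℕ) (ω : ℝ≥0 → ℝ≥0) (m : ℕ+) :
    Submodule ℂ (EuclideanSpace ℝ (Fin N) → ℂ) where
  carrier := {f | ∃ n : ℕ+, f ∈ stepSub N ω m n}
  add_mem' := by
    rintro f g ⟨n, hf⟩ ⟨n', hg⟩
    exact ⟨max n n', (stepSub N ω m _).add_mem (stepSub_mono ω m (le_max_left _ _) hf)
      (stepSub_mono ω m (le_max_right _ _) hg)⟩
  zero_mem' := ⟨1, (stepSub N ω m 1).zero_mem⟩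
  smul_mem' := by
    rintro c f ⟨n, hf⟩
    exact ⟨n, (stepSub N ω m n).smul_mem c hf⟩

/-- The space `⋃_n O^m_{n,ω}(ℝ^N)`, to be equipped with the inductive topology. -/
def UnionSpace (N : ℕ) (ω : ℝ≥0 → ℝ≥0) (m : ℕ+) : Type := unionSub N ω m

instance (ω : ℝ≥0 → ℝ≥0) (m : ℕ+) : AddCommGroup (UnionSpace N ω m) :=
  inferInstanceAs (AddCommGroup (unionSub N ω m))

instance (ω : ℝ≥0 → ℝ≥0) (m : ℕ+) : Module ℂ (UnionSpace N ω m) :=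
  inferInstanceAs (Module ℂ (unionSub N ω m))

/-- An element of the union, as a function on `ℝ^N`. -/
def UnionSpace.fn {ω : ℝ≥0 → ℝ≥0} {m : ℕ+} (f : UnionSpace N ω m) :
    EuclideanSpace ℝ (Fin N) → ℂ :=
  Subtype.val (p := (· ∈ unionSub N ω m)) f

/-- The canonical inclusion `O^m_{n,ω} → O^m_{n',ω}` for `n ≤ n'`. -/
def stepToStep (N : ℕ) (ω : ℝ≥0 → ℝ≥0) (m : ℕ+) {n n' : ℕ+} (h : n ≤ n') :
    Step N ω m n →ₗ[ℂ] Step N ω m n' :=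
  Submodule.inclusion (stepSub_mono ω m h)

/-- The canonical inclusion `j_n` of the `n`-th step into the union. -/
def stepToUnion (N : ℕ) (ω : ℝ≥0 → ℝ≥0) (m n : ℕ+) : Step N ω m n →ₗ[ℂ] UnionSpace N ω m :=
  Submodule.inclusion (show stepSub N ω m n ≤ unionSub N ω m from fun _ hf => ⟨n, hf⟩)

/-- `t` is a locally convex vector space topology on the complex vector space `X`. -/
structure IsLC {X : Type*} [AddCommGroup X] [Module ℂ X] (t : TopologicalSpace X) : Prop where
  addGroup : @IsTopologicalAddGroup X t _
  smul : @ContinuousSMul ℂ X _ _ t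
  locallyConvex : @LocallyConvexSpace ℝ X _ _ _ _ t

theorem IsLC.sInf {X : Type*} [AddCommGroup X] [Module ℂ X] {T : Set (TopologicalSpace X)}
    (h : ∀ t ∈ T, IsLC t) : IsLC (sInf T) where
  addGroup := topologicalAddGroup_sInf fun t ht => (h t ht).addGroup
  smul := continuousSMul_sInf fun t ht => (h t ht).smul
  locallyConvex := .sInf fun t ht => (h t ht).locallyConvex

/-- The inductive topology: the finest locally convex topology on `⋃_n O^m_{n,ω}` for which all
inclusions `(O^m_{n,ω}, r_{m,n}) → ⋃_n O^m_{n,ω}` are continuous. -/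
instance unionTopology (ω : ℝ≥0 → ℝ≥0) (m : ℕ+) : TopologicalSpace (UnionSpace N ω m) :=
  sInf {t | IsLC t ∧ ∀ n : ℕ+, Continuous[inferInstance, t] (stepToUnion N ω m n)}

theorem isLC_unionTopology (ω : ℝ≥0 → ℝ≥0) (m : ℕ+) :
    IsLC (unionTopology (N := N) ω m) :=
  IsLC.sInf fun _ h => h.1

/-! ### The space `S_ω` -/

/-- `f^(ξ) = ∫ f(x) exp (-i x·ξ) dx`. -/
def fourier (f : EuclideanSpace ℝ (Fin N) → ℂ) : EuclideanSpace ℝ (Fin N) → ℂ :=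
  fun ξ => ∫ x, f x * Complex.exp (-Complex.I * ((inner ℝ x ξ : ℝ) : ℂ))

/-- `sup_x exp (λ ω(|x|)) |∂^α f(x)| < ∞` for all `λ > 0` and all `α`. -/
def OmegaDecay (ω : ℝ≥0 → ℝ≥0) (f : EuclideanSpace ℝ (Fin N) → ℂ) : Prop :=
  ∀ l : ℝ, 0 < l → ∀ α : Fin N → ℕ, ∃ C : ℝ, ∀ x, Real.exp (l * ω ‖x‖₊) * ‖mderiv α f x‖ ≤ C

/-- The set `S_ω(ℝ^N)`. -/
def SOmega (N : ℕ) (ω : ℝ≥0 → ℝ≥0) : Set (EuclideanSpace ℝ (Fin N) → ℂ) :=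
  {f | MeasureTheory.Integrable f ∧ ContDiff ℝ (⊤ : ℕ∞) f ∧ ContDiff ℝ (⊤ : ℕ∞) (fourier f) ∧
    OmegaDecay ω f ∧ OmegaDecay ω (fourier f)}

theorem mderiv_zero (α : Fin N → ℕ) : mderiv α (0 : EuclideanSpace ℝ (Fin N) → ℂ) = 0 := by
  have h := (smoothLin_mderiv α).smul 0 0 contDiff_const
  simpa using h

instance (ω : ℝ≥0 → ℝ≥0) : Nonempty (SOmega N ω) := by
  have h0 : fourier (0 : EuclideanSpace ℝ (Fin N) → ℂ) = 0 := by
    funext ξ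
    simp [fourier]
  have hd : OmegaDecay ω (0 : EuclideanSpace ℝ (Fin N) → ℂ) := fun l _ α =>
    ⟨0, fun x => by simp [mderiv_zero]⟩
  exact ⟨0, MeasureTheory.integrable_zero _ _ _, contDiff_const, h0.symm ▸ contDiff_const, hd,
    h0.symm ▸ hd⟩

/-! ### The space `(O^m_{s_ω}, τ_m)` -/

/-- The weight `|g(x)| exp (-m φ*(|α| / m))` defining `q_{m,g}`. -/
def testWeight (ω : ℝ≥0 → ℝ≥0) (m : ℕ+) (g : EuclideanSpace ℝ (Fin N) → ℂ)
    (α : Fin N → ℕ) (x : EuclideanSpace ℝ (Fin N)) : ℝ≥0∞ :=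
  ‖g x‖ₑ * derivFactor ω m (mlen α)

/-- `O^m_{s_ω}` as a space of functions: smooth `f` with `q_{m,g}(f) < ∞` for all `g ∈ S_ω`. -/
def multSub (N : ℕ) (ω : ℝ≥0 → ℝ≥0) (m : ℕ+) :
    Submodule ℂ (EuclideanSpace ℝ (Fin N) → ℂ) :=
  finiteSub (fun g : SOmega N ω => testWeight ω m g.1)

/-- The space `O^m_{s_ω}(ℝ^N)`, to be equipped with the topology `τ_m`. -/
def MultSpace (N : ℕ) (ω : ℝ≥0 → ℝ≥0) (m : ℕ+) : Type := multSub N ω m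

instance (ω : ℝ≥0 → ℝ≥0) (m : ℕ+) : AddCommGroup (MultSpace N ω m) :=
  inferInstanceAs (AddCommGroup (multSub N ω m))

instance (ω : ℝ≥0 → ℝ≥0) (m : ℕ+) : Module ℂ (MultSpace N ω m) :=
  inferInstanceAs (Module ℂ (multSub N ω m))

/-- An element of `O^m_{s_ω}`, as a function on `ℝ^N`. -/
def MultSpace.fn {ω : ℝ≥0 → ℝ≥0} {m : ℕ+} (f : MultSpace N ω m) :
    EuclideanSpace ℝ (Fin N) → ℂ :=
  Subtype.val (p := (· ∈ multSub N ω m)) f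

/-- The seminorms `q_{m,g}`, `g ∈ S_ω`. -/
def multSeminorms (N : ℕ) (ω : ℝ≥0 → ℝ≥0) (m : ℕ+) :
    SeminormFamily ℂ (MultSpace N ω m) (SOmega N ω) :=
  fun g => finiteSeminorm (fun g : SOmega N ω => testWeight ω m g.1) g

/-- `τ_m`, the locally convex topology generated by all the `q_{m,g}`. -/
instance multTopology (ω : ℝ≥0 → ℝ≥0) (m : ℕ+) : TopologicalSpace (MultSpace N ω m) :=
  (multSeminorms N ω m).moduleFilterBasis.topology

theorem withSeminorms_mult (ω : ℝ≥0 → ℝ≥0) (m : ℕ+) : WithSeminorms (multSeminorms N ω m) :=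
  ⟨rfl⟩

/-! ### The associated bornological space -/

/-- The bornological space associated with a locally convex space `X`: the same vector space,
with the finest locally convex topology in which every bounded subset of `X` stays bounded. -/
def Bornologification (X : Type*) : Type _ := X

/-- The identity map from the bornological space associated with `X` to `X`. -/
def Bornologification.out {X : Type*} (x : Bornologification X) : X := x

instance (X : Type*) [AddCommGroup X] : AddCommGroup (Bornologification X) :=
  inferInstanceAs (AddCommGroup X)

instance (X : Type*) [AddCommGroup X] [Module ℂ X] : Module ℂ (Bornologification X) :=
  inferInstanceAs (Module ℂ X)

instance bornTopology (X : Type*) [AddCommGroup X] [Module ℂ X] [TopologicalSpace X] :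
    TopologicalSpace (Bornologification X) :=
  sInf {t | IsLC t ∧ ∀ B : Set X, Bornology.IsVonNBounded ℂ B →
    @Bornology.IsVonNBounded ℂ (Bornologification X) _ _ _ t B}

theorem isLC_bornTopology (X : Type*) [AddCommGroup X] [Module ℂ X] [TopologicalSpace X] :
    IsLC (bornTopology X) :=
  IsLC.sInf fun _ h => h.1

end OmegaMult

end

noncomputable section

namespace OmegaMult

open scoped ENNReal NNReal Topology
open MeasureTheory Filter

variable {N : ℕ}

/-! ### Growth of weight functions -/

/-! Everything about boundedness rests on `IsWeight.exists_wsup_stepWeight_le`: a set of functions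
bounded for every `q_{m,g}` is bounded for a single `r_{m,n}`. Otherwise there are `f_j` in the set,
multi-indices `α_j` and points `x_j` at which the expression defining `r_{m,j+1}(f_j)` exceeds
`4^j`. One test function then detects all of these failures: `g = ∑ 2^{-j} exp(-j ω(x_j)) G(x -
x_j)`, with `G` the standard Gaussian. As all terms are nonnegative, `g(x_j) ≥ 2^{-j} exp(-j
ω(x_j))`, so `q_{m,g}(f_j) ≥ 2^j` for all `j`, a contradiction.

That `g` lies in `S_ω` (`IsWeight.bumpSum_mem_sOmega`) needs no condition on the points. By (β), `ω`
grows at most linearly, so Gaussians absorb `exp(λω)`; by (α), a translation by `x_j` costs a factor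
`exp(L ω(x_j))`; by (γ), so does the power of `1 + |x_j|` produced by differentiating the modulated
Gaussians of `ĝ`. The coefficients absorb both.

Conversely `q_{m,g} ≤ C r_{m,n}`, so bounded sets of the union are `τ_m`-bounded, hence bounded in a
step. This gives regularity, and equality of the function spaces when applied to singletons. The
topologies agree because normed steps are bornological and the inductive topology keeps
`τ_m`-bounded sets bounded.

The limit is Hausdorff because point evaluations are continuous on every step. If `φ*` is finite, a
Cauchy sequence in a step has all derivatives uniformly Cauchy on balls, and the limits are the
derivatives of one function. -/

theorem IsWeight.exists_le_linear {ω : ℝ≥0 → ℝ≥0} (hω : IsWeight ω) :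
    ∃ C : ℝ, 0 ≤ C ∧ ∀ t : ℝ≥0, (ω t : ℝ) ≤ C * (1 + t) := by
  set I := ∫ t in Set.Ioi (1 : ℝ), (ω t.toNNReal : ℝ) / (1 + t ^ 2) with hI
  have hnn : ∀ t : ℝ, 0 ≤ (ω t.toNNReal : ℝ) / (1 + t ^ 2) := fun t => by positivity
  have hI0 : 0 ≤ I := integral_nonneg hnn
  -- For `t ≥ 1` and `s` in `(t, 2t]`, `1 + s² ≤ 5t²` and `ω(t) ≤ ω(s)`, so `ω(t)/(5t)` is at most
  -- the integral over `(t, 2t]`. The term `ω 1` covers `t ≤ 1`.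
  refine ⟨ω 1 + 5 * I, by positivity, fun t => ?_⟩
  rcases le_total t 1 with ht | ht
  · have h1 : (ω t : ℝ) ≤ ω 1 := by exact_mod_cast hω.mono ht
    have h2 : (0 : ℝ) ≤ t := t.2
    have h3 : (0 : ℝ) ≤ ω 1 := (ω 1).2
    nlinarith [mul_nonneg h3 h2, mul_nonneg hI0 h2]
  · have ht' : (1 : ℝ) ≤ t := by exact_mod_cast ht
    have hsub : Set.Ioc (t : ℝ) (2 * t) ⊆ Set.Ioi 1 := fun s hs => lt_of_le_of_lt ht' hs.1
    have h1 : ∫ s in Set.Ioc (t : ℝ) (2 * t), (ω s.toNNReal : ℝ) / (1 + s ^ 2) ≤ I :=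
      setIntegral_mono_set hω.beta (ae_of_all _ hnn) (LE.le.eventuallyLE hsub)
    have h2 : ∫ s in Set.Ioc (t : ℝ) (2 * t), (ω t : ℝ) / (5 * t ^ 2) ≤
        ∫ s in Set.Ioc (t : ℝ) (2 * t), (ω s.toNNReal : ℝ) / (1 + s ^ 2) := by
      refine setIntegral_mono_on (by simp) (hω.beta.mono_set hsub) measurableSet_Ioc
        fun s hs => ?_
      have hs1 : (ω t : ℝ) ≤ ω s.toNNReal := by
        exact_mod_cast hω.mono (NNReal.le_toNNReal_of_coe_le hs.1.le)
      have hs2 : 1 + s ^ 2 ≤ 5 * (t : ℝ) ^ 2 := by nlinarith [hs.1, hs.2]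
      gcongr
    have h3 : ∫ s in Set.Ioc (t : ℝ) (2 * t), (ω t : ℝ) / (5 * t ^ 2) = (ω t : ℝ) / (5 * t) := by
      rw [setIntegral_const]
      simp only [measureReal_def, Real.volume_Ioc, smul_eq_mul]
      rw [ENNReal.toReal_ofReal (by linarith)]
      field_simp
      ring
    have h4 : (ω t : ℝ) / (5 * t) ≤ I := h3 ▸ h2.trans h1
    rw [div_le_iff₀ (by positivity)] at h4
    have h3 : (0 : ℝ) ≤ ω 1 := (ω 1).2
    nlinarith [mul_nonneg h3 t.2]

theorem IsWeight.exists_pow_le {ω : ℝ≥0 → ℝ≥0} (hω : IsWeight ω) (n : ℕ) :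
    ∃ C L : ℝ, 0 ≤ C ∧ 0 ≤ L ∧ ∀ t : ℝ≥0, (1 + (t : ℝ)) ^ n ≤ C * Real.exp (L * ω t) := by
  obtain ⟨a, b, hb, h⟩ := hω.gamma
  refine ⟨Real.exp (-(n * a / b)), n / b, (Real.exp_pos _).le, by positivity, fun t => ?_⟩
  have ht : (0 : ℝ) < 1 + t := by positivity
  rw [← Real.exp_add, ← Real.log_le_iff_le_exp (by positivity), Real.log_pow]
  have : Real.log (1 + t) ≤ (ω t - a) / b := by
    rw [le_div_iff₀ hb]
    linarith [h t]
  calc (n : ℝ) * Real.log (1 + t) ≤ n * ((ω t - a) / b) := by gcongr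
    _ = _ := by ring

/-- A substitute for subadditivity: `|x| ≤ 2 max(|y|, |x - y|)`, then monotonicity and (α). -/
theorem IsWeight.exists_le_add {ω : ℝ≥0 → ℝ≥0} (hω : IsWeight ω) :
    ∃ K : ℝ, 0 ≤ K ∧ ∀ x y : EuclideanSpace ℝ (Fin N),
      (ω ‖x‖₊ : ℝ) ≤ K * (1 + ω ‖y‖₊ + ω ‖x - y‖₊) := by
  obtain ⟨K, hK, h⟩ := hω.alpha
  refine ⟨K, by linarith, fun x y => ?_⟩
  have h1 : ‖x‖₊ ≤ 2 * max ‖y‖₊ ‖x - y‖₊ := by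
    calc ‖x‖₊ = ‖y + (x - y)‖₊ := by simp
      _ ≤ ‖y‖₊ + ‖x - y‖₊ := nnnorm_add_le _ _
      _ ≤ max ‖y‖₊ ‖x - y‖₊ + max ‖y‖₊ ‖x - y‖₊ :=
        add_le_add (le_max_left _ _) (le_max_right _ _)
      _ = _ := (two_mul _).symm
  have h2 : (ω (max ‖y‖₊ ‖x - y‖₊) : ℝ) ≤ ω ‖y‖₊ + ω ‖x - y‖₊ := by
    rcases max_choice ‖y‖₊ ‖x - y‖₊ with h | h <;> rw [h]
    · exact le_add_of_nonneg_right (NNReal.coe_nonneg _)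
    · exact le_add_of_nonneg_left (NNReal.coe_nonneg _)
  calc (ω ‖x‖₊ : ℝ) ≤ ω (2 * max ‖y‖₊ ‖x - y‖₊) := by exact_mod_cast hω.mono h1
    _ ≤ K * (1 + ω (max ‖y‖₊ ‖x - y‖₊)) := h _
    _ ≤ K * (1 + ω ‖y‖₊ + ω ‖x - y‖₊) := by
      apply mul_le_mul_of_nonneg_left _ (by linarith)
      linarith

theorem IsWeight.exists_pow_mul_exp_le {ω : ℝ≥0 → ℝ≥0} (hω : IsWeight ω) (k : ℕ) {l : ℝ}
    (hl : 0 ≤ l) : ∃ C : ℝ, 0 ≤ C ∧ ∀ t : ℝ≥0,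
      Real.exp (l * ω t) * ((1 + (t : ℝ)) ^ k * Real.exp (-(t : ℝ) ^ 2 / 2)) ≤ C := by
  obtain ⟨C, hC, h⟩ := hω.exists_le_linear
  -- The exponent is at most `lC + (lC + k)t - t²/2`, which is maximal at `t = lC + k`.
  refine ⟨Real.exp (l * C + (l * C + k) ^ 2 / 2), (Real.exp_pos _).le, fun t => ?_⟩
  have h1 : (1 + (t : ℝ)) ^ k ≤ Real.exp (k * t) := by
    rw [Real.exp_nat_mul]
    gcongr
    linarith [Real.add_one_le_exp (t : ℝ)]
  calc Real.exp (l * ω t) * ((1 + (t : ℝ)) ^ k * Real.exp (-(t : ℝ) ^ 2 / 2))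
      ≤ Real.exp (l * (C * (1 + t))) * (Real.exp (k * t) * Real.exp (-(t : ℝ) ^ 2 / 2)) := by
        gcongr
        exact h t
    _ = Real.exp (l * (C * (1 + t)) + (k * t + -(t : ℝ) ^ 2 / 2)) := by
        rw [Real.exp_add, Real.exp_add]
    _ ≤ _ := by
        rw [Real.exp_le_exp]
        nlinarith [sq_nonneg ((l * C + k) - (t : ℝ))]

/-! ### Iterated partial derivatives and the iterated Fréchet derivative -/

theorem pderiv_iteratedFDeriv_apply {f : EuclideanSpace ℝ (Fin N) → ℂ}
    (hf : ContDiff ℝ (⊤ : ℕ∞) f) (i : Fin N) (k : ℕ) (v : Fin k → EuclideanSpace ℝ (Fin N)) :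
    pderiv i (fun x => iteratedFDeriv ℝ k f x v) =
      fun x => iteratedFDeriv ℝ (k + 1) f x (Fin.cons (EuclideanSpace.single i 1) v) := by
  funext x
  rw [pderiv, iteratedFDeriv_succ_apply_left, Fin.cons_zero, Fin.tail_cons,
    fderiv_continuousMultilinear_apply_const_apply]
  exact (hf.differentiable_iteratedFDeriv (m := k) (by exact_mod_cast ENat.natCast_lt_top k)) x

/-- Lets the estimates run on iterated Fréchet derivatives, where term-by-term differentiation and
composition bounds are available. The value of `k` plays no role later. -/
theorem exists_mderiv_eq_iteratedFDeriv {f : EuclideanSpace ℝ (Fin N) → ℂ}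
    (hf : ContDiff ℝ (⊤ : ℕ∞) f) (α : Fin N → ℕ) :
    ∃ (k : ℕ) (v : Fin k → EuclideanSpace ℝ (Fin N)), (∀ i, ‖v i‖ ≤ 1) ∧
      mderiv α f = fun x => iteratedFDeriv ℝ k f x v := by
  unfold mderiv
  induction List.finRange N with
  | nil => exact ⟨0, Fin.elim0, fun i => i.elim0, by simp⟩
  | cons i l ih =>
    rw [List.foldr_cons]
    induction α i with
    | zero => exact ih
    | succ n ihn =>
      obtain ⟨k, v, hv, h⟩ := ihn
      refine ⟨k + 1, Fin.cons (EuclideanSpace.single i 1) v, fun j => ?_, ?_⟩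
      · refine Fin.cases ?_ (fun j => ?_) j
        · simp
        · simpa using hv j
      · rw [Function.iterate_succ_apply', h, pderiv_iteratedFDeriv_apply hf]

theorem exists_norm_mderiv_le {f : EuclideanSpace ℝ (Fin N) → ℂ}
    (hf : ContDiff ℝ (⊤ : ℕ∞) f) (α : Fin N → ℕ) :
    ∃ k : ℕ, ∀ x, ‖mderiv α f x‖ ≤ ‖iteratedFDeriv ℝ k f x‖ := by
  obtain ⟨k, v, hv, h⟩ := exists_mderiv_eq_iteratedFDeriv hf α
  refine ⟨k, fun x => ?_⟩
  rw [h]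
  exact (ContinuousMultilinearMap.le_opNorm _ _).trans (mul_le_of_le_one_right (norm_nonneg _)
    (Finset.prod_le_one (fun _ _ => norm_nonneg _) fun i _ => hv i))

theorem mderiv_zero_index (f : EuclideanSpace ℝ (Fin N) → ℂ) : mderiv 0 f = f := by
  unfold mderiv
  induction List.finRange N with
  | nil => rfl
  | cons i l ih => exact ih

/-! ### Rapidly decreasing series -/

/-- The case `l = 0` of the hypothesis justifies differentiating term by term; the other `l` then
bound the differentiated series. -/
theorem contDiff_tsum_of_decay {ω : ℝ≥0 → ℝ≥0} {f : ℕ → EuclideanSpace ℝ (Fin N) → ℂ}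
    (hf : ∀ j, ContDiff ℝ (⊤ : ℕ∞) (f j))
    (hd : ∀ (k : ℕ) (l : ℝ), 0 ≤ l → ∃ u : ℕ → ℝ, Summable u ∧
      ∀ j x, Real.exp (l * ω ‖x‖₊) * ‖iteratedFDeriv ℝ k (f j) x‖ ≤ u j) :
    ContDiff ℝ (⊤ : ℕ∞) (fun x => ∑' j, f j x) ∧ OmegaDecay ω (fun x => ∑' j, f j x) := by
  have h0 : ∀ k : ℕ, ∃ u : ℕ → ℝ, Summable u ∧ ∀ j x, ‖iteratedFDeriv ℝ k (f j) x‖ ≤ u j := by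
    intro k
    simpa using hd k 0 le_rfl
  choose u hu hfu using h0
  have hsm : ContDiff ℝ (⊤ : ℕ∞) (fun x => ∑' j, f j x) :=
    contDiff_tsum hf (fun k _ => hu k) (fun k i x _ => hfu k i x)
  refine ⟨hsm, fun l hl α => ?_⟩
  obtain ⟨k, hk⟩ := exists_norm_mderiv_le hsm α
  obtain ⟨w, hw, hfw⟩ := hd k l hl.le
  refine ⟨∑' j, w j, fun x => ?_⟩
  have hs : Summable fun j => ‖iteratedFDeriv ℝ k (f j) x‖ :=
    (hu k).of_nonneg_of_le (fun _ => norm_nonneg _) fun j => hfu k j x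
  calc Real.exp (l * ω ‖x‖₊) * ‖mderiv α (fun x => ∑' j, f j x) x‖
      ≤ Real.exp (l * ω ‖x‖₊) * ‖iteratedFDeriv ℝ k (fun x => ∑' j, f j x) x‖ := by
        gcongr
        exact hk x
    _ = Real.exp (l * ω ‖x‖₊) * ‖∑' j, iteratedFDeriv ℝ k (f j) x‖ := by
        rw [iteratedFDeriv_tsum (N := ⊤) hf (fun k _ => hu k) (fun k i x _ => hfu k i x)
          (by exact le_top)]
    _ ≤ Real.exp (l * ω ‖x‖₊) * ∑' j, ‖iteratedFDeriv ℝ k (f j) x‖ := by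
        gcongr
        exact norm_tsum_le_tsum_norm hs
    _ = ∑' j, Real.exp (l * ω ‖x‖₊) * ‖iteratedFDeriv ℝ k (f j) x‖ := tsum_mul_left.symm
    _ ≤ ∑' j, w j := (hs.mul_left _).tsum_le_tsum (fun j => hfw j x) hw

theorem OmegaDecay.integrable {ω : ℝ≥0 → ℝ≥0} (hω : IsWeight ω)
    {f : EuclideanSpace ℝ (Fin N) → ℂ} (hf : ContDiff ℝ (⊤ : ℕ∞) f) (hd : OmegaDecay ω f) :
    Integrable f := by
  obtain ⟨C, L, hC, hL, h⟩ := hω.exists_pow_le (N + 1)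
  -- `OmegaDecay` is only available for positive exponents, and `L` may vanish.
  obtain ⟨B, hB⟩ := hd (L + 1) (by linarith) 0
  rw [mderiv_zero_index] at hB
  have hi : Integrable (fun x : EuclideanSpace ℝ (Fin N) =>
      (C * B) * (1 + ‖x‖) ^ (-((N + 1 : ℕ) : ℝ))) :=
    (integrable_one_add_norm (by simp)).const_mul _
  refine hi.mono' hf.continuous.aestronglyMeasurable (ae_of_all _ fun x => ?_)
  have hx := h ‖x‖₊
  rw [coe_nnnorm] at hx
  rw [Real.rpow_neg (by positivity), Real.rpow_natCast, ← div_eq_mul_inv,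
    le_div_iff₀ (by positivity)]
  calc ‖f x‖ * (1 + ‖x‖) ^ (N + 1) ≤ ‖f x‖ * (C * Real.exp (L * ω ‖x‖₊)) := by gcongr
    _ ≤ ‖f x‖ * (C * Real.exp ((L + 1) * ω ‖x‖₊)) := by
        gcongr
        linarith
    _ = C * (Real.exp ((L + 1) * ω ‖x‖₊) * ‖f x‖) := by ring
    _ ≤ C * B := by
        gcongr
        exact hB x

/-! ### Modulated Gaussians -/

/-- The modulated Gaussian `exp (-|x|²/2 - i a·x)`. -/
def gaussWave (a x : EuclideanSpace ℝ (Fin N)) : ℂ :=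
  Complex.exp (-(1 / 2 : ℂ) * (‖x‖ : ℂ) ^ 2 + -Complex.I * ((inner ℝ a x : ℝ) : ℂ))

theorem norm_gaussWave (a x : EuclideanSpace ℝ (Fin N)) :
    ‖gaussWave a x‖ = Real.exp (-‖x‖ ^ 2 / 2) := by
  rw [gaussWave, Complex.norm_exp]
  congr 1
  simp [← Complex.ofReal_pow]
  ring

theorem gaussWave_zero (x : EuclideanSpace ℝ (Fin N)) :
    gaussWave 0 x = ((Real.exp (-‖x‖ ^ 2 / 2) : ℝ) : ℂ) := by
  rw [gaussWave, Complex.ofReal_exp]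
  congr 1
  simp
  ring

/-- The real derivative of `exp` is `exp` followed by the multiplication map `ℂ → (ℂ →L[ℝ] ℂ)`,
which has norm at most one, so no constant accumulates in the induction. -/
theorem norm_iteratedFDeriv_cexp_le (n : ℕ) (z : ℂ) :
    ‖iteratedFDeriv ℝ n Complex.exp z‖ ≤ ‖Complex.exp z‖ := by
  induction n with
  | zero => simp
  | succ n ih =>
    rw [← norm_iteratedFDeriv_fderiv]
    have h : fderiv ℝ Complex.exp = ContinuousLinearMap.mul ℝ ℂ ∘ Complex.exp := by
      funext w
      rw [((Complex.hasDerivAt_exp w).complexToReal_fderiv).fderiv]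
      ext
      all_goals simp
    rw [h]
    refine ((ContinuousLinearMap.mul ℝ ℂ).norm_iteratedFDeriv_comp_left (n := n)
      (Complex.contDiff_exp (𝕜 := ℝ) (n := n)).contDiffAt le_rfl).trans ?_
    exact (mul_le_of_le_one_left (norm_nonneg _)
      (ContinuousLinearMap.opNorm_mul_le ℝ ℂ)).trans ih

theorem norm_iteratedFDeriv_clm_le {E F : Type*} [NormedAddCommGroup E] [NormedSpace ℝ E]
    [NormedAddCommGroup F] [NormedSpace ℝ F] (L : E →L[ℝ] F) {n : ℕ} (hn : 1 ≤ n) (x : E) :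
    ‖iteratedFDeriv ℝ n L x‖ ≤ ‖L‖ := by
  obtain ⟨n, rfl⟩ := Nat.exists_eq_add_of_le' hn
  have h : fderiv ℝ L = fun _ => L := by
    funext y
    exact L.fderiv
  rw [← norm_iteratedFDeriv_fderiv, h]
  rcases n with _ | n
  · simp
  · rw [iteratedFDeriv_const_of_ne (Nat.succ_ne_zero n)]
    simp

/-- The linear form `x ↦ -i a·x`. -/
def phase (a : EuclideanSpace ℝ (Fin N)) : EuclideanSpace ℝ (Fin N) →L[ℝ] ℂ :=
  (-Complex.I) • (Complex.ofRealCLM.comp (innerSL ℝ a))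

theorem phase_apply (a x : EuclideanSpace ℝ (Fin N)) :
    phase a x = -Complex.I * ((inner ℝ a x : ℝ) : ℂ) := by
  simp [phase]

theorem norm_phase_le (a : EuclideanSpace ℝ (Fin N)) : ‖phase a‖ ≤ ‖a‖ := by
  refine ContinuousLinearMap.opNorm_le_bound _ (norm_nonneg _) fun x => ?_
  rw [phase_apply, norm_mul, norm_neg, Complex.norm_I, one_mul, Complex.norm_real]
  exact norm_inner_le_norm a x

theorem hasTemperateGrowth_neg_half_norm_sq :
    (fun x : EuclideanSpace ℝ (Fin N) => -(1 / 2 : ℂ) * (‖x‖ : ℂ) ^ 2).HasTemperateGrowth := by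
  have h : (fun x : EuclideanSpace ℝ (Fin N) => -(1 / 2 : ℂ) * (‖x‖ : ℂ) ^ 2) =
      fun x => -(1 / 2 : ℂ) * Complex.ofReal (‖x‖ ^ 2) := by
    funext x
    simp
  rw [h]
  exact (Function.HasTemperateGrowth.const _).mul (Function.HasTemperateGrowth.comp
    Function.Complex.hasTemperateGrowth_ofReal
    (Function.hasTemperateGrowth_norm_sq (EuclideanSpace ℝ (Fin N))))

theorem gaussWave_eq_comp (a : EuclideanSpace ℝ (Fin N)) :
    gaussWave a = Complex.exp ∘ ((fun x => -(1 / 2 : ℂ) * (‖x‖ : ℂ) ^ 2) + ⇑(phase a)) := by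
  funext x
  simp [gaussWave, phase_apply]

theorem contDiff_gaussWave (a : EuclideanSpace ℝ (Fin N)) :
    ContDiff ℝ (⊤ : ℕ∞) (gaussWave a) := by
  rw [gaussWave_eq_comp]
  exact Complex.contDiff_exp.comp (hasTemperateGrowth_neg_half_norm_sq.1.add (phase a).contDiff)

/-- A Faà di Bruno estimate for `exp ∘ (-|x|²/2 + phase a)`. The outer derivatives have size
`exp(-|x|²/2)` for every `a`, so `a` enters only through the linear phase, polynomially. -/
theorem exists_norm_iteratedFDeriv_gaussWave_le (N n : ℕ) : ∃ (C : ℝ) (k : ℕ), 0 ≤ C ∧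
    ∀ a x : EuclideanSpace ℝ (Fin N), ‖iteratedFDeriv ℝ n (gaussWave a) x‖ ≤
      C * (1 + ‖a‖) ^ n * ((1 + ‖x‖) ^ k * Real.exp (-‖x‖ ^ 2 / 2)) := by
  obtain ⟨k, C, hC, h⟩ :=
    (hasTemperateGrowth_neg_half_norm_sq (N := N)).norm_iteratedFDeriv_le_uniform n
  refine ⟨n.factorial * (1 + C) ^ n, k * n, by positivity, fun a x => ?_⟩
  have hD : ∀ i : ℕ, 1 ≤ i → i ≤ n →
      ‖iteratedFDeriv ℝ i ((fun x => -(1 / 2 : ℂ) * (‖x‖ : ℂ) ^ 2) + ⇑(phase a)) x‖ ≤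
        ((1 + C) * (1 + ‖a‖) * (1 + ‖x‖) ^ k) ^ i := by
    intro i hi hin
    have hp : 1 ≤ (1 + ‖x‖) ^ k := one_le_pow₀ (by linarith [norm_nonneg x])
    have h1 : ‖iteratedFDeriv ℝ i ((fun x => -(1 / 2 : ℂ) * (‖x‖ : ℂ) ^ 2) + ⇑(phase a)) x‖ ≤
        C * (1 + ‖x‖) ^ k + ‖a‖ := by
      rw [iteratedFDeriv_add_apply
        (hasTemperateGrowth_neg_half_norm_sq.1.of_le (by exact_mod_cast le_top)).contDiffAt
        (phase a).contDiff.contDiffAt]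
      exact (norm_add_le _ _).trans (add_le_add (h i hin x)
        ((norm_iteratedFDeriv_clm_le _ hi x).trans (norm_phase_le a)))
    have h2 : C * (1 + ‖x‖) ^ k + ‖a‖ ≤ (1 + C) * (1 + ‖a‖) * (1 + ‖x‖) ^ k := by
      have h3 : ‖a‖ ≤ ‖a‖ * (1 + ‖x‖) ^ k := le_mul_of_one_le_right (norm_nonneg a) hp
      have h4 : 0 ≤ C * ‖a‖ * (1 + ‖x‖) ^ k := by positivity
      nlinarith
    -- The composition bound wants `D^i` for the `i`-th inner derivative; a bound by `D` suffices
    -- since `D ≥ 1` and `i ≥ 1`.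
    have h5 : 1 ≤ (1 + C) * (1 + ‖a‖) * (1 + ‖x‖) ^ k :=
      one_le_mul_of_one_le_of_one_le (one_le_mul_of_one_le_of_one_le (by linarith)
        (by linarith [norm_nonneg a])) hp
    exact (h1.trans h2).trans (le_self_pow₀ h5 (by omega))
  have hz : ∀ i ≤ n, ‖iteratedFDeriv ℝ i Complex.exp
      (((fun y : EuclideanSpace ℝ (Fin N) => -(1 / 2 : ℂ) * (‖y‖ : ℂ) ^ 2) + ⇑(phase a)) x)‖ ≤ Real.exp (-‖x‖ ^ 2 / 2) := by
    intro i _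
    refine (norm_iteratedFDeriv_cexp_le i _).trans (le_of_eq ?_)
    rw [← norm_gaussWave a x, gaussWave_eq_comp]
    rfl
  rw [gaussWave_eq_comp]
  refine (norm_iteratedFDeriv_comp_le (Complex.contDiff_exp (𝕜 := ℝ) (n := (⊤ : ℕ∞)))
    (hasTemperateGrowth_neg_half_norm_sq.1.add (phase a).contDiff) (by exact_mod_cast le_top) x
    hz hD).trans (le_of_eq ?_)
  rw [mul_pow, mul_pow, ← pow_mul]
  ring

theorem IsWeight.exists_decay_gaussWave {ω : ℝ≥0 → ℝ≥0} (hω : IsWeight ω) (N n : ℕ) {l : ℝ}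
    (hl : 0 ≤ l) : ∃ C : ℝ, 0 ≤ C ∧ ∀ a x : EuclideanSpace ℝ (Fin N),
      Real.exp (l * ω ‖x‖₊) * ‖iteratedFDeriv ℝ n (gaussWave a) x‖ ≤ C * (1 + ‖a‖) ^ n := by
  obtain ⟨C, k, hC, h⟩ := exists_norm_iteratedFDeriv_gaussWave_le N n
  obtain ⟨B, hB, h'⟩ := hω.exists_pow_mul_exp_le k hl
  refine ⟨C * B, by positivity, fun a x => ?_⟩
  calc Real.exp (l * ω ‖x‖₊) * ‖iteratedFDeriv ℝ n (gaussWave a) x‖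
      ≤ Real.exp (l * ω ‖x‖₊) *
        (C * (1 + ‖a‖) ^ n * ((1 + ‖x‖) ^ k * Real.exp (-‖x‖ ^ 2 / 2))) := by
        gcongr
        exact h a x
    _ = C * (1 + ‖a‖) ^ n *
        (Real.exp (l * ω ‖x‖₊) * ((1 + ‖x‖) ^ k * Real.exp (-‖x‖ ^ 2 / 2))) := by ring
    _ ≤ C * (1 + ‖a‖) ^ n * B := by
        gcongr
        exact h' ‖x‖₊
    _ = _ := by ring

theorem integrable_gaussWave (a : EuclideanSpace ℝ (Fin N)) : Integrable (gaussWave a) :=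
  GaussianFourier.integrable_cexp_neg_mul_sq_norm_add (by simp) _ _

/-- Translation turns into modulation, and the Gaussian is its own transform up to the factor
`(2π)^{N/2}`. -/
theorem fourier_gaussWave_zero_sub (a ξ : EuclideanSpace ℝ (Fin N)) :
    fourier (fun x => gaussWave 0 (x - a)) ξ =
      ((Real.pi : ℂ) / (1 / 2)) ^ ((N : ℂ) / 2) * gaussWave a ξ := by
  have h1 : ∀ x : EuclideanSpace ℝ (Fin N), gaussWave 0 (x - a) *
      Complex.exp (-Complex.I * ((inner ℝ x ξ : ℝ) : ℂ)) =
      (fun y => Complex.exp (-Complex.I * ((inner ℝ a ξ : ℝ) : ℂ)) * gaussWave ξ y) (x - a) := by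
    intro x
    simp only [gaussWave]
    rw [← Complex.exp_add, ← Complex.exp_add]
    congr 1
    simp only [inner_sub_right, inner_zero_left]
    rw [real_inner_comm x ξ, real_inner_comm ξ a]
    push_cast
    ring
  unfold fourier
  simp_rw [h1]
  rw [integral_sub_right_eq_self
    (fun y => Complex.exp (-Complex.I * ((inner ℝ a ξ : ℝ) : ℂ)) * gaussWave ξ y) a,
    integral_const_mul]
  have h2 := GaussianFourier.integral_cexp_neg_mul_sq_norm_add (b := (1 / 2 : ℂ)) (by simp)
    (-Complex.I) ξ
  simp only [gaussWave]
  rw [h2, finrank_euclideanSpace_fin, mul_left_comm, ← Complex.exp_add]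
  congr 2
  rw [neg_sq, Complex.I_sq]
  ring

/-! ### Superpositions of translated Gaussians -/

/-- The coefficients `2^{-j} exp (-j ω(x_j))`. -/
def bumpCoeff (ω : ℝ≥0 → ℝ≥0) (p : ℕ → EuclideanSpace ℝ (Fin N)) (j : ℕ) : ℝ :=
  (1 / 2) ^ j * Real.exp (-(j * ω ‖p j‖₊))

theorem bumpCoeff_nonneg (ω : ℝ≥0 → ℝ≥0) (p : ℕ → EuclideanSpace ℝ (Fin N)) (j : ℕ) :
    0 ≤ bumpCoeff ω p j := by
  unfold bumpCoeff
  positivity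

/-- Once `j ≥ L`, the factor `exp(-(j - L) ω(p_j))` is at most one and `2^{-j}` remains, wherever
the points lie. -/
theorem summable_bumpCoeff_mul_exp (ω : ℝ≥0 → ℝ≥0) (p : ℕ → EuclideanSpace ℝ (Fin N)) (L : ℝ) :
    Summable fun j => bumpCoeff ω p j * Real.exp (L * ω ‖p j‖₊) := by
  refine Summable.of_norm_bounded_eventually_nat (g := fun j => (1 / 2 : ℝ) ^ j)
    summable_geometric_two ?_
  filter_upwards [eventually_ge_atTop ⌈L⌉₊] with j hj
  have hL : L ≤ j := Nat.ceil_le.1 hj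
  rw [Real.norm_of_nonneg (mul_nonneg (bumpCoeff_nonneg ω p j) (Real.exp_pos _).le), bumpCoeff,
    mul_assoc, ← Real.exp_add]
  refine mul_le_of_le_one_right (by positivity) (Real.exp_le_one_iff.2 ?_)
  nlinarith [(ω ‖p j‖₊).2]

theorem IsWeight.summable_bumpCoeff_mul_pow {ω : ℝ≥0 → ℝ≥0} (hω : IsWeight ω)
    (p : ℕ → EuclideanSpace ℝ (Fin N)) (n : ℕ) :
    Summable fun j => bumpCoeff ω p j * (1 + ‖p j‖) ^ n := by
  obtain ⟨C, L, hC, hL, h⟩ := hω.exists_pow_le n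
  refine ((summable_bumpCoeff_mul_exp ω p L).mul_left C).of_nonneg_of_le
    (fun j => mul_nonneg (bumpCoeff_nonneg ω p j) (by positivity)) fun j => ?_
  calc bumpCoeff ω p j * (1 + ‖p j‖) ^ n
      ≤ bumpCoeff ω p j * (C * Real.exp (L * ω ‖p j‖₊)) :=
        mul_le_mul_of_nonneg_left (h ‖p j‖₊) (bumpCoeff_nonneg ω p j)
    _ = _ := by ring

theorem summable_bumpCoeff (ω : ℝ≥0 → ℝ≥0) (p : ℕ → EuclideanSpace ℝ (Fin N)) :
    Summable (bumpCoeff ω p) := by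
  simpa using summable_bumpCoeff_mul_exp ω p 0

/-- The superposition `∑_j 2^{-j} exp (-j ω(x_j)) G(x - x_j)` of translates of the standard
Gaussian `G`. -/
def bumpSum (ω : ℝ≥0 → ℝ≥0) (p : ℕ → EuclideanSpace ℝ (Fin N)) :
    EuclideanSpace ℝ (Fin N) → ℂ :=
  fun x => ∑' j, (bumpCoeff ω p j : ℂ) • gaussWave 0 (x - p j)

theorem iteratedFDeriv_const_smul_complex {f : EuclideanSpace ℝ (Fin N) → ℂ}
    (hf : ContDiff ℝ (⊤ : ℕ∞) f) (c : ℂ) (k : ℕ) (x : EuclideanSpace ℝ (Fin N)) :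
    ‖iteratedFDeriv ℝ k (fun y => c • f y) x‖ = ‖c‖ * ‖iteratedFDeriv ℝ k f x‖ := by
  have := iteratedFDeriv_const_smul_apply (𝕜 := ℝ) (i := k) (a := c) (x := x)
    (hf.of_le (by exact_mod_cast le_top)).contDiffAt
  rw [← norm_smul, ← this]
  rfl

/-- By `exists_le_add`, `exp(l ω(x))` splits into a factor at `p j`, absorbed by the coefficient,
and one at `x - p j`, absorbed by the Gaussian. -/
theorem IsWeight.bumpSum_decay {ω : ℝ≥0 → ℝ≥0} (hω : IsWeight ω)
    (p : ℕ → EuclideanSpace ℝ (Fin N)) :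
    ContDiff ℝ (⊤ : ℕ∞) (bumpSum ω p) ∧ OmegaDecay ω (bumpSum ω p) := by
  have hs : ∀ j, ContDiff ℝ (⊤ : ℕ∞) fun x => gaussWave 0 (x - p j) := fun j =>
    (contDiff_gaussWave 0).comp (contDiff_id.sub contDiff_const)
  refine contDiff_tsum_of_decay (fun j => (hs j).const_smul _) fun k l hl => ?_
  obtain ⟨K, hK, hadd⟩ := hω.exists_le_add (N := N)
  obtain ⟨C, hC, h⟩ := hω.exists_decay_gaussWave N k (mul_nonneg hl hK)
  refine ⟨_, (summable_bumpCoeff_mul_exp ω p (l * K)).mul_left (Real.exp (l * K) * C),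
    fun j x => ?_⟩
  rw [iteratedFDeriv_const_smul_complex (hs j), iteratedFDeriv_comp_sub, Complex.norm_real,
    Real.norm_of_nonneg (bumpCoeff_nonneg ω p j)]
  have h1 : Real.exp (l * ω ‖x‖₊) ≤ Real.exp (l * K) * Real.exp (l * K * ω ‖p j‖₊) *
      Real.exp (l * K * ω ‖x - p j‖₊) := by
    rw [← Real.exp_add, ← Real.exp_add, Real.exp_le_exp]
    nlinarith [mul_le_mul_of_nonneg_left (hadd x (p j)) hl]
  have h2 := h 0 (x - p j)
  rw [norm_zero, add_zero, one_pow, mul_one] at h2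
  have hc := bumpCoeff_nonneg ω p j
  calc Real.exp (l * ω ‖x‖₊) *
        (bumpCoeff ω p j * ‖iteratedFDeriv ℝ k (gaussWave 0) (x - p j)‖)
      ≤ (Real.exp (l * K) * Real.exp (l * K * ω ‖p j‖₊) * Real.exp (l * K * ω ‖x - p j‖₊)) *
        (bumpCoeff ω p j * ‖iteratedFDeriv ℝ k (gaussWave 0) (x - p j)‖) := by gcongr
    _ = (Real.exp (l * K) * (bumpCoeff ω p j * Real.exp (l * K * ω ‖p j‖₊))) *
        (Real.exp (l * K * ω ‖x - p j‖₊) *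
          ‖iteratedFDeriv ℝ k (gaussWave 0) (x - p j)‖) := by ring
    _ ≤ (Real.exp (l * K) * (bumpCoeff ω p j * Real.exp (l * K * ω ‖p j‖₊))) * C := by gcongr
    _ = _ := by ring

/-- Sum and integral commute because the `j`-th term has `L¹` norm `bumpCoeff ω p j` times that of
the Gaussian. -/
theorem fourier_bumpSum (ω : ℝ≥0 → ℝ≥0) (p : ℕ → EuclideanSpace ℝ (Fin N)) :
    fourier (bumpSum ω p) = fun ξ => ∑' j, ((bumpCoeff ω p j : ℂ) *
      ((Real.pi : ℂ) / (1 / 2)) ^ ((N : ℂ) / 2)) • gaussWave (p j) ξ := by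
  funext ξ
  have hn : ∀ x : EuclideanSpace ℝ (Fin N),
      ‖Complex.exp (-Complex.I * ((inner ℝ x ξ : ℝ) : ℂ))‖ = 1 := fun x => by
    rw [Complex.norm_exp]
    simp
  have hi : ∀ j, Integrable fun x => gaussWave 0 (x - p j) := fun j =>
    (integrable_gaussWave 0).comp_sub_right (p j)
  have hF : ∀ j, Integrable fun x : EuclideanSpace ℝ (Fin N) =>
      ((bumpCoeff ω p j : ℂ) • gaussWave 0 (x - p j)) *
        Complex.exp (-Complex.I * ((inner ℝ x ξ : ℝ) : ℂ)) := fun j =>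
    ((hi j).smul (bumpCoeff ω p j : ℂ)).mul_bdd (c := 1)
      (Continuous.aestronglyMeasurable (by fun_prop)) (ae_of_all _ fun x => (hn x).le)
  have hS : Summable fun j => ∫ x : EuclideanSpace ℝ (Fin N),
      ‖((bumpCoeff ω p j : ℂ) • gaussWave 0 (x - p j)) *
        Complex.exp (-Complex.I * ((inner ℝ x ξ : ℝ) : ℂ))‖ := by
    have : ∀ j, ∫ x : EuclideanSpace ℝ (Fin N),
        ‖((bumpCoeff ω p j : ℂ) • gaussWave 0 (x - p j)) *
          Complex.exp (-Complex.I * ((inner ℝ x ξ : ℝ) : ℂ))‖ =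
        bumpCoeff ω p j * ∫ x : EuclideanSpace ℝ (Fin N), ‖gaussWave 0 x‖ := fun j => by
      rw [← integral_sub_right_eq_self (fun x => ‖gaussWave 0 x‖) (p j), ← integral_const_mul]
      refine integral_congr_ae (ae_of_all _ fun x => ?_)
      simp only
      rw [norm_mul, hn, mul_one, norm_smul, Complex.norm_real,
        Real.norm_of_nonneg (bumpCoeff_nonneg ω p j)]
    simp_rw [this]
    exact (summable_bumpCoeff ω p).mul_right _
  have h := integral_tsum_of_summable_integral_norm hF hS
  unfold fourier bumpSum
  simp_rw [← tsum_mul_right]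
  rw [← h]
  refine tsum_congr fun j => ?_
  simp_rw [smul_eq_mul, mul_assoc]
  rw [integral_const_mul]
  congr 1
  exact fourier_gaussWave_zero_sub (p j) ξ

theorem IsWeight.bumpSum_mem_sOmega {ω : ℝ≥0 → ℝ≥0} (hω : IsWeight ω)
    (p : ℕ → EuclideanSpace ℝ (Fin N)) : bumpSum ω p ∈ SOmega N ω := by
  obtain ⟨hs, hd⟩ := hω.bumpSum_decay p
  have hf : ContDiff ℝ (⊤ : ℕ∞) (fourier (bumpSum ω p)) ∧
      OmegaDecay ω (fourier (bumpSum ω p)) := by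
    rw [fourier_bumpSum]
    refine contDiff_tsum_of_decay (fun j => (contDiff_gaussWave (p j)).const_smul _)
      fun k l hl => ?_
    obtain ⟨C, hC, h⟩ := hω.exists_decay_gaussWave N k hl
    set D := ‖((Real.pi : ℂ) / (1 / 2)) ^ ((N : ℂ) / 2)‖
    refine ⟨_, (hω.summable_bumpCoeff_mul_pow p k).mul_left (D * C), fun j x => ?_⟩
    rw [iteratedFDeriv_const_smul_complex (contDiff_gaussWave (p j)), norm_mul,
      Complex.norm_real, Real.norm_of_nonneg (bumpCoeff_nonneg ω p j)]
    have hc := bumpCoeff_nonneg ω p j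
    calc Real.exp (l * ω ‖x‖₊) *
          (bumpCoeff ω p j * D * ‖iteratedFDeriv ℝ k (gaussWave (p j)) x‖)
        = (bumpCoeff ω p j * D) *
          (Real.exp (l * ω ‖x‖₊) * ‖iteratedFDeriv ℝ k (gaussWave (p j)) x‖) := by ring
      _ ≤ (bumpCoeff ω p j * D) * (C * (1 + ‖p j‖) ^ k) := by
          exact mul_le_mul_of_nonneg_left (h (p j) x) (mul_nonneg hc (norm_nonneg _))
      _ = _ := by ring
  exact ⟨hd.integrable hω hs, hs, hf.1, hd, hf.2⟩

theorem bumpCoeff_le_norm_bumpSum (ω : ℝ≥0 → ℝ≥0) (p : ℕ → EuclideanSpace ℝ (Fin N)) (j : ℕ) :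
    bumpCoeff ω p j ≤ ‖bumpSum ω p (p j)‖ := by
  have h1 : ∀ x, bumpSum ω p x =
      ((∑' j, bumpCoeff ω p j * Real.exp (-‖x - p j‖ ^ 2 / 2) : ℝ) : ℂ) := fun x => by
    rw [Complex.ofReal_tsum]
    refine tsum_congr fun i => ?_
    rw [gaussWave_zero, smul_eq_mul, Complex.ofReal_mul]
  have hnn : ∀ i, 0 ≤ bumpCoeff ω p i * Real.exp (-‖p j - p i‖ ^ 2 / 2) := fun i =>
    mul_nonneg (bumpCoeff_nonneg ω p i) (Real.exp_pos _).le
  have hs : Summable fun i => bumpCoeff ω p i * Real.exp (-‖p j - p i‖ ^ 2 / 2) :=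
    (summable_bumpCoeff ω p).of_nonneg_of_le hnn fun i =>
      mul_le_of_le_one_right (bumpCoeff_nonneg ω p i)
        (Real.exp_le_one_iff.2 (by have := sq_nonneg ‖p j - p i‖; linarith))
  rw [h1, Complex.norm_real, Real.norm_of_nonneg (tsum_nonneg hnn)]
  simpa using hs.le_tsum j fun i _ => hnn i

/-! ### Comparison of the weighted suprema -/

theorem le_wsup (w : (Fin N → ℕ) → EuclideanSpace ℝ (Fin N) → ℝ≥0∞)
    (f : EuclideanSpace ℝ (Fin N) → ℂ) (α : Fin N → ℕ) (x : EuclideanSpace ℝ (Fin N)) :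
    ‖mderiv α f x‖ₑ * w α x ≤ wsup w f :=
  le_iSup₂ (f := fun α x => ‖mderiv α f x‖ₑ * w α x) α x

theorem IsWeight.exists_wsup_stepWeight_le {ω : ℝ≥0 → ℝ≥0} (hω : IsWeight ω) (m : ℕ+)
    (S : Set (EuclideanSpace ℝ (Fin N) → ℂ))
    (hS : ∀ g ∈ SOmega N ω, ∃ C : ℝ≥0, ∀ f ∈ S, wsup (testWeight ω m g) f ≤ C) :
    ∃ (n : ℕ+) (C : ℝ≥0), ∀ f ∈ S, wsup (stepWeight ω m n) f ≤ C := by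
  by_contra! hcon
  -- The threshold `4^j` outweighs the coefficient `2^{-j}` and leaves `2^j`. The step index is `j +
  -- 1` since it must be positive; this is harmless as `exp(-(j+1)ω) ≤ exp(-jω)`.
  choose f hfS hf using fun j : ℕ => hcon j.succPNat (4 ^ j)
  have hex : ∀ j : ℕ, ∃ (α : Fin N → ℕ) (x : EuclideanSpace ℝ (Fin N)),
      (((4 : ℝ≥0) ^ j : ℝ≥0) : ℝ≥0∞) <
        ‖mderiv α (f j) x‖ₑ * stepWeight ω m j.succPNat α x := fun j => by
    simpa only [wsup, lt_iSup_iff] using hf j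
  choose α p hp using hex
  obtain ⟨C, hC⟩ := hS _ (hω.bumpSum_mem_sOmega p)
  obtain ⟨j, hj⟩ := pow_unbounded_of_one_lt C (one_lt_two : (1 : ℝ≥0) < 2)
  have hw : ENNReal.ofReal ((1 / 2) ^ j) * stepWeight ω m j.succPNat (α j) (p j) ≤
      testWeight ω m (bumpSum ω p) (α j) (p j) := by
    unfold stepWeight testWeight
    rw [← mul_assoc, ← ENNReal.ofReal_mul (by positivity), ← ofReal_norm]
    gcongr
    refine le_trans ?_ (bumpCoeff_le_norm_bumpSum ω p j)
    unfold bumpCoeff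
    gcongr
    rw [neg_mul, neg_le_neg_iff, Nat.succPNat_coe]
    gcongr
    exact Nat.le_succ j
  have h2 : (((2 : ℝ≥0) ^ j : ℝ≥0) : ℝ≥0∞) ≤ C := by
    calc (((2 : ℝ≥0) ^ j : ℝ≥0) : ℝ≥0∞)
        = ENNReal.ofReal ((1 / 2) ^ j) * (((4 : ℝ≥0) ^ j : ℝ≥0) : ℝ≥0∞) := by
          rw [ENNReal.ofReal, ← ENNReal.coe_mul, ENNReal.coe_inj]
          apply NNReal.coe_injective
          rw [NNReal.coe_mul, Real.coe_toNNReal _ (by positivity), NNReal.coe_pow, NNReal.coe_pow,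
            ← mul_pow]
          norm_num
      _ ≤ ENNReal.ofReal ((1 / 2) ^ j) *
          (‖mderiv (α j) (f j) (p j)‖ₑ * stepWeight ω m j.succPNat (α j) (p j)) := by
          gcongr
          exact (hp j).le
      _ = ‖mderiv (α j) (f j) (p j)‖ₑ *
          (ENNReal.ofReal ((1 / 2) ^ j) * stepWeight ω m j.succPNat (α j) (p j)) :=
          mul_left_comm _ _ _
      _ ≤ ‖mderiv (α j) (f j) (p j)‖ₑ * testWeight ω m (bumpSum ω p) (α j) (p j) := by gcongr
      _ ≤ wsup (testWeight ω m (bumpSum ω p)) (f j) := le_wsup _ _ _ _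
      _ ≤ C := hC _ (hfS j)
  exact absurd (ENNReal.coe_le_coe.1 h2) (not_le.2 hj)

theorem exists_wsup_testWeight_le {ω : ℝ≥0 → ℝ≥0} (m n : ℕ+)
    {g : EuclideanSpace ℝ (Fin N) → ℂ} (hg : g ∈ SOmega N ω) :
    ∃ C : ℝ≥0, ∀ f : EuclideanSpace ℝ (Fin N) → ℂ,
      wsup (testWeight ω m g) f ≤ C * wsup (stepWeight ω m n) f := by
  obtain ⟨C, hC⟩ := hg.2.2.2.1 (n : ℕ) (by exact_mod_cast n.pos) 0
  rw [mderiv_zero_index] at hC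
  refine ⟨C.toNNReal, fun f => iSup₂_le fun α x => ?_⟩
  have h1 : ‖g x‖ₑ ≤ C.toNNReal * ENNReal.ofReal (Real.exp (-((n : ℕ) : ℝ) * ω ‖x‖₊)) := by
    rw [← ofReal_norm, show (C.toNNReal : ℝ≥0∞) = ENNReal.ofReal C from rfl,
      ← ENNReal.ofReal_mul' (Real.exp_pos _).le]
    refine ENNReal.ofReal_le_ofReal ?_
    rw [neg_mul, Real.exp_neg, ← div_eq_mul_inv, le_div_iff₀ (Real.exp_pos _), mul_comm]
    exact hC x
  calc ‖mderiv α f x‖ₑ * testWeight ω m g α x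
      ≤ ‖mderiv α f x‖ₑ * (C.toNNReal *
        ENNReal.ofReal (Real.exp (-((n : ℕ) : ℝ) * ω ‖x‖₊)) * derivFactor ω m (mlen α)) := by
        unfold testWeight
        gcongr
    _ = C.toNNReal * (‖mderiv α f x‖ₑ * stepWeight ω m n α x) := by
        unfold stepWeight
        ring
    _ ≤ C.toNNReal * wsup (stepWeight ω m n) f := by
        gcongr
        exact le_wsup _ _ _ _

theorem IsWeight.unionSub_eq_multSub {ω : ℝ≥0 → ℝ≥0} (hω : IsWeight ω) (m : ℕ+) :
    unionSub N ω m = multSub N ω m := by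
  refine le_antisymm ?_ ?_
  · rintro f ⟨n, hf, hr⟩
    refine ⟨hf, fun g => ?_⟩
    obtain ⟨C, hC⟩ := exists_wsup_testWeight_le m n g.2
    exact (hC f).trans_lt (ENNReal.mul_lt_top ENNReal.coe_lt_top (hr ()))
  · rintro f ⟨hf, hq⟩
    obtain ⟨n, C, h⟩ := hω.exists_wsup_stepWeight_le m {f} fun g hg =>
      ⟨(wsup (testWeight ω m g) f).toNNReal, by
        rintro _ rfl
        exact (ENNReal.coe_toNNReal (hq ⟨g, hg⟩).ne).ge⟩
    exact ⟨n, hf, fun _ => (h f rfl).trans_lt ENNReal.coe_lt_top⟩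

/-! ### Positivity of the weights -/

theorem youngConj_ne_bot (ω : ℝ≥0 → ℝ≥0) (s : ℝ) : youngConj ω s ≠ ⊥ :=
  ne_bot_of_le_ne_bot (EReal.coe_ne_bot _) (le_iSup (fun t : ℝ≥0 =>
    ((s * t - ω (Real.exp t).toNNReal : ℝ) : EReal)) 0)

/-- Ensures that the weight of order zero is positive even when `φ*` takes the value `∞`. -/
theorem youngConj_zero_lt_top (ω : ℝ≥0 → ℝ≥0) : youngConj ω 0 < ⊤ := by
  refine lt_of_le_of_lt (iSup_le fun t => ?_) EReal.zero_lt_top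
  rw [← EReal.coe_zero, EReal.coe_le_coe_iff]
  simp

theorem derivFactor_lt_top (ω : ℝ≥0 → ℝ≥0) (m : ℕ+) (k : ℕ) : derivFactor ω m k < ∞ := by
  unfold derivFactor
  have hm : (0 : ℝ) < (m : ℕ) := by exact_mod_cast m.pos
  rw [EReal.exp_lt_top_iff]
  generalize hy : youngConj ω ((k : ℝ) / ((m : ℕ) : ℝ)) = y
  have hb : y ≠ ⊥ := hy ▸ youngConj_ne_bot ω _
  induction y with
  | bot => exact absurd rfl hb
  | coe r =>
    rw [← EReal.coe_neg, ← EReal.coe_mul]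
    exact EReal.coe_lt_top _
  | top =>
    rw [← EReal.coe_neg, EReal.coe_mul_top_of_neg (by linarith)]
    exact bot_lt_top

theorem derivFactor_pos {ω : ℝ≥0 → ℝ≥0} {m : ℕ+} {k : ℕ}
    (h : youngConj ω ((k : ℝ) / ((m : ℕ) : ℝ)) < ⊤) : 0 < derivFactor ω m k := by
  unfold derivFactor
  rw [pos_iff_ne_zero, Ne, EReal.exp_eq_zero_iff, ← Ne, ← bot_lt_iff_ne_bot]
  lift youngConj ω ((k : ℝ) / ((m : ℕ) : ℝ)) to ℝ using ⟨h.ne, youngConj_ne_bot ω _⟩ with r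
  rw [← EReal.coe_neg, ← EReal.coe_mul]
  exact EReal.bot_lt_coe _

theorem stepWeight_toReal (ω : ℝ≥0 → ℝ≥0) (m n : ℕ+) (α : Fin N → ℕ)
    (x : EuclideanSpace ℝ (Fin N)) : (stepWeight ω m n α x).toReal =
      Real.exp (-((n : ℕ) : ℝ) * ω ‖x‖₊) * (derivFactor ω m (mlen α)).toReal := by
  rw [stepWeight, ENNReal.toReal_mul, ENNReal.toReal_ofReal (Real.exp_pos _).le]

theorem stepWeight_lt_top (ω : ℝ≥0 → ℝ≥0) (m n : ℕ+) (α : Fin N → ℕ)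
    (x : EuclideanSpace ℝ (Fin N)) : stepWeight ω m n α x < ∞ :=
  ENNReal.mul_lt_top ENNReal.ofReal_lt_top (derivFactor_lt_top ω m _)

theorem stepWeight_zero_toReal_pos (ω : ℝ≥0 → ℝ≥0) (m n : ℕ+)
    (x : EuclideanSpace ℝ (Fin N)) : 0 < (stepWeight ω m n 0 x).toReal := by
  rw [stepWeight_toReal]
  refine mul_pos (Real.exp_pos _)
    (ENNReal.toReal_pos (derivFactor_pos ?_).ne' (derivFactor_lt_top ω m _).ne)
  simpa [mlen] using youngConj_zero_lt_top ω

/-! ### The steps -/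

/-- An element of `O^m_{n,ω}`, as a function on `ℝ^N`. -/
def Step.fn {ω : ℝ≥0 → ℝ≥0} {m n : ℕ+} (f : Step N ω m n) : EuclideanSpace ℝ (Fin N) → ℂ :=
  Subtype.val (p := (· ∈ stepSub N ω m n)) f

theorem Step.norm_def {ω : ℝ≥0 → ℝ≥0} {m n : ℕ+} (f : Step N ω m n) :
    ‖f‖ = (wsup (stepWeight ω m n) f.fn).toReal := rfl

theorem Step.mem {ω : ℝ≥0 → ℝ≥0} {m n : ℕ+} (f : Step N ω m n) : f.fn ∈ stepSub N ω m n :=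
  Subtype.prop (p := (· ∈ stepSub N ω m n)) f

theorem Step.contDiff {ω : ℝ≥0 → ℝ≥0} {m n : ℕ+} (f : Step N ω m n) :
    ContDiff ℝ (⊤ : ℕ∞) f.fn := f.mem.1

theorem Step.wsup_lt_top {ω : ℝ≥0 → ℝ≥0} {m n : ℕ+} (f : Step N ω m n) :
    wsup (stepWeight ω m n) f.fn < ∞ := f.mem.2 ()

theorem Step.norm_mderiv_mul_le {ω : ℝ≥0 → ℝ≥0} {m n : ℕ+} (f : Step N ω m n) (α : Fin N → ℕ)
    (x : EuclideanSpace ℝ (Fin N)) :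
    ‖mderiv α f.fn x‖ * (stepWeight ω m n α x).toReal ≤ ‖f‖ := by
  have h := ENNReal.toReal_mono f.wsup_lt_top.ne (le_wsup (stepWeight ω m n) f.fn α x)
  rwa [ENNReal.toReal_mul, toReal_enorm] at h

theorem wsup_stepWeight_anti (ω : ℝ≥0 → ℝ≥0) (m : ℕ+) {n n' : ℕ+} (h : n ≤ n')
    (f : EuclideanSpace ℝ (Fin N) → ℂ) :
    wsup (stepWeight ω m n') f ≤ wsup (stepWeight ω m n) f := by
  refine iSup₂_mono fun α x => ?_
  have : ((n : ℕ) : ℝ) ≤ ((n' : ℕ) : ℝ) := by exact_mod_cast h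
  unfold stepWeight
  gcongr

theorem Step.norm_stepToStep_le {ω : ℝ≥0 → ℝ≥0} {m n n' : ℕ+} (h : n ≤ n') (f : Step N ω m n) :
    ‖stepToStep N ω m h f‖ ≤ ‖f‖ :=
  ENNReal.toReal_mono f.wsup_lt_top.ne (wsup_stepWeight_anti ω m h f.fn)

theorem continuous_stepToStep (ω : ℝ≥0 → ℝ≥0) (m : ℕ+) {n n' : ℕ+} (h : n ≤ n') :
    Continuous (stepToStep N ω m h) :=
  AddMonoidHomClass.continuous_of_bound (stepToStep N ω m h) 1 fun f =>
    (Step.norm_stepToStep_le h f).trans_eq (one_mul _).symm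

/-! ### The inductive topology -/

theorem IsLC.induced {X Y : Type*} [AddCommGroup X] [Module ℂ X] [AddCommGroup Y] [Module ℂ Y]
    {t : TopologicalSpace Y} (h : IsLC t) (T : X →ₗ[ℂ] Y) : IsLC (t.induced T) where
  addGroup := by
    have := h.addGroup
    exact topologicalAddGroup_induced T
  smul := by
    have := h.smul
    exact continuousSMul_induced T
  locallyConvex := by
    have := h.locallyConvex
    exact LocallyConvexSpace.induced (T.restrictScalars ℝ)

theorem continuous_stepToUnion (ω : ℝ≥0 → ℝ≥0) (m n : ℕ+) : Continuous (stepToUnion N ω m n) :=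
  continuous_sInf_rng.2 fun _ ht => ht.2 n

/-- The topology induced by `T` is one of those over which the inductive topology is the infimum. -/
theorem continuous_of_comp_stepToUnion {ω : ℝ≥0 → ℝ≥0} {m : ℕ+} {F : Type*} [AddCommGroup F]
    [Module ℂ F] [t : TopologicalSpace F] (hF : IsLC t) (T : UnionSpace N ω m →ₗ[ℂ] F)
    (h : ∀ n, Continuous (T ∘ₗ stepToUnion N ω m n)) : Continuous T :=
  continuous_iff_le_induced.2 (sInf_le ⟨hF.induced T, fun n => continuous_induced_rng.2 (h n)⟩)

/-- The inclusion of the union into the space of all functions. -/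
def unionToFun (N : ℕ) (ω : ℝ≥0 → ℝ≥0) (m : ℕ+) :
    UnionSpace N ω m →ₗ[ℂ] (EuclideanSpace ℝ (Fin N) → ℂ) :=
  (unionSub N ω m).subtype

theorem continuous_unionToFun (N : ℕ) (ω : ℝ≥0 → ℝ≥0) (m : ℕ+) :
    Continuous (unionToFun N ω m) := by
  refine continuous_of_comp_stepToUnion ⟨inferInstance, inferInstance, inferInstance⟩ _
    fun n => continuous_pi fun x => ?_
  refine AddMonoidHomClass.continuous_of_bound
    ((LinearMap.proj x : (EuclideanSpace ℝ (Fin N) → ℂ) →ₗ[ℂ] ℂ) ∘ₗ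
      (unionToFun N ω m ∘ₗ stepToUnion N ω m n)) (stepWeight ω m n 0 x).toReal⁻¹ fun f => ?_
  have h := f.norm_mderiv_mul_le 0 x
  rw [mderiv_zero_index] at h
  rw [mul_comm, ← div_eq_mul_inv, le_div_iff₀ (stepWeight_zero_toReal_pos ω m n x)]
  exact h

theorem t2Space_unionSpace (N : ℕ) (ω : ℝ≥0 → ℝ≥0) (m : ℕ+) : T2Space (UnionSpace N ω m) :=
  T2Space.of_injective_continuous (f := unionToFun N ω m) (unionSub N ω m).injective_subtype
    (continuous_unionToFun N ω m)

theorem t2Space_step (N : ℕ) (ω : ℝ≥0 → ℝ≥0) (m n : ℕ+) : T2Space (Step N ω m n) :=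
  have := t2Space_unionSpace N ω m
  T2Space.of_injective_continuous (f := stepToUnion N ω m n) (Submodule.inclusion_injective _)
    (continuous_stepToUnion ω m n)

/-! ### Regularity and the associated bornological space -/

theorem isLC_multTopology (ω : ℝ≥0 → ℝ≥0) (m : ℕ+) : IsLC (multTopology (N := N) ω m) where
  addGroup := (withSeminorms_mult ω m).topologicalAddGroup
  smul := (withSeminorms_mult ω m).continuousSMul
  locallyConvex := (withSeminorms_mult ω m).toLocallyConvexSpace

/-- The union and `O^m_{s_ω}` consist of the same functions. -/
def unionEquivMult (N : ℕ) {ω : ℝ≥0 → ℝ≥0} (hω : IsWeight ω) (m : ℕ+) :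
    UnionSpace N ω m ≃ₗ[ℂ] MultSpace N ω m :=
  LinearEquiv.ofEq _ _ (hω.unionSub_eq_multSub m)

theorem unionEquivMult_fn {ω : ℝ≥0 → ℝ≥0} (hω : IsWeight ω) (m : ℕ+) (f : UnionSpace N ω m) :
    (unionEquivMult N hω m f).fn = f.fn := rfl

theorem multSeminorms_apply {ω : ℝ≥0 → ℝ≥0} {m : ℕ+} (g : SOmega N ω) (f : MultSpace N ω m) :
    multSeminorms N ω m g f = (wsup (testWeight ω m g.1) f.fn).toReal := rfl

theorem continuous_unionEquivMult {ω : ℝ≥0 → ℝ≥0} (hω : IsWeight ω) (m : ℕ+) :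
    Continuous (unionEquivMult N hω m) := by
  have := (isLC_multTopology (N := N) ω m).addGroup
  refine continuous_of_comp_stepToUnion (isLC_multTopology ω m)
    (unionEquivMult N hω m).toLinearMap fun n => ?_
  refine continuous_of_continuousAt_zero _ ?_
  rw [ContinuousAt, map_zero, (withSeminorms_mult ω m).tendsto_nhds _ 0]
  intro g ε hε
  obtain ⟨C, hC⟩ := exists_wsup_testWeight_le m n g.2
  have hlim : Tendsto (fun f : Step N ω m n => (C : ℝ) * ‖f‖) (𝓝 0) (𝓝 0) := by
    have := (continuous_norm (E := Step N ω m n)).const_mul (C : ℝ) |>.tendsto 0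
    simpa using this
  filter_upwards [hlim.eventually (gt_mem_nhds hε)] with f hf
  rw [sub_zero]
  refine lt_of_le_of_lt ?_ hf
  have h := ENNReal.toReal_mono
    (ENNReal.mul_lt_top ENNReal.coe_lt_top f.wsup_lt_top).ne (hC f.fn)
  rwa [ENNReal.toReal_mul, ENNReal.coe_toReal] at h

/-- Boundedness is assumed only for `τ_m`, so this serves both regularity and the comparison with
the bornological topology. -/
theorem exists_step_of_isVonNBounded {ω : ℝ≥0 → ℝ≥0} (hω : IsWeight ω) (m : ℕ+)
    (B : Set (UnionSpace N ω m)) (hB : Bornology.IsVonNBounded ℂ (unionEquivMult N hω m '' B)) :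
    ∃ (n : ℕ+) (A : Set (Step N ω m n)), Bornology.IsBounded A ∧ stepToUnion N ω m n '' A = B := by
  rw [(withSeminorms_mult ω m).isVonNBounded_iff_seminorm_bounded] at hB
  obtain ⟨n, C, hC⟩ := hω.exists_wsup_stepWeight_le m (UnionSpace.fn '' B) fun g hg => by
    obtain ⟨r, -, hr⟩ := hB ⟨g, hg⟩
    refine ⟨r.toNNReal, ?_⟩
    rintro _ ⟨f, hf, rfl⟩
    have h1 := hr _ ⟨f, hf, rfl⟩
    rw [multSeminorms_apply, unionEquivMult_fn] at h1
    have h2 : wsup (testWeight ω m g) f.fn < ∞ :=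
      (Subtype.prop (p := (· ∈ multSub N ω m)) (unionEquivMult N hω m f)).2 ⟨g, hg⟩
    exact (ENNReal.le_ofReal_iff_toReal_le h2.ne (ENNReal.toReal_nonneg.trans h1.le)).2 h1.le
  refine ⟨n, stepToUnion N ω m n ⁻¹' B, ?_, ?_⟩
  · refine isBounded_iff_forall_norm_le.2 ⟨C, fun f hf => ?_⟩
    rw [Step.norm_def]
    exact ENNReal.toReal_le_coe_of_le_coe (hC _ ⟨_, hf, rfl⟩)
  · refine Set.image_preimage_eq_of_subset fun f hf => ?_
    have hmem : f.fn ∈ stepSub N ω m n :=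
      ⟨(Subtype.prop (p := (· ∈ multSub N ω m)) (unionEquivMult N hω m f)).1,
        fun _ => (hC _ ⟨f, hf, rfl⟩).trans_lt ENNReal.coe_lt_top⟩
    exact ⟨(⟨f.fn, hmem⟩ : stepSub N ω m n), rfl⟩

theorem isVonNBounded_of_image_unionEquivMult {ω : ℝ≥0 → ℝ≥0} (hω : IsWeight ω) (m : ℕ+)
    (B : Set (UnionSpace N ω m)) (hB : Bornology.IsVonNBounded ℂ (unionEquivMult N hω m '' B)) :
    Bornology.IsVonNBounded ℂ B := by
  obtain ⟨n, A, hA, rfl⟩ := exists_step_of_isVonNBounded hω m B hB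
  exact ((NormedSpace.isVonNBounded_iff ℂ).2 hA).image
    (⟨stepToUnion N ω m n, continuous_stepToUnion ω m n⟩ : Step N ω m n →L[ℂ] UnionSpace N ω m)

theorem isVonNBounded_image_unionEquivMult {ω : ℝ≥0 → ℝ≥0} (hω : IsWeight ω) (m : ℕ+)
    {B : Set (UnionSpace N ω m)} (hB : Bornology.IsVonNBounded ℂ B) :
    Bornology.IsVonNBounded ℂ (unionEquivMult N hω m '' B) :=
  hB.image (⟨(unionEquivMult N hω m).toLinearMap, continuous_unionEquivMult hω m⟩ :
    UnionSpace N ω m →L[ℂ] MultSpace N ω m)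

/-- `unionEquivMult` with values in the associated bornological space. -/
def unionEquivBorn (N : ℕ) {ω : ℝ≥0 → ℝ≥0} (hω : IsWeight ω) (m : ℕ+) :
    UnionSpace N ω m ≃ₗ[ℂ] Bornologification (MultSpace N ω m) :=
  unionEquivMult N hω m

theorem continuous_unionEquivBorn {ω : ℝ≥0 → ℝ≥0} (hω : IsWeight ω) (m : ℕ+) :
    Continuous (unionEquivBorn N hω m) := by
  refine continuous_sInf_rng.2 fun t ht => ?_
  have := ht.1.addGroup
  refine continuous_of_comp_stepToUnion ht.1 (unionEquivBorn N hω m).toLinearMap fun n => ?_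
  -- A linear map on a normed space is continuous once it preserves bounded sets; here these pass
  -- through the union and `τ_m` into `t`.
  refine LinearMap.continuous_of_locally_bounded _ fun s hs => ?_
  rw [LinearMap.coe_comp, Set.image_comp]
  exact ht.2 _ (isVonNBounded_image_unionEquivMult hω m (hs.image
    (⟨stepToUnion N ω m n, continuous_stepToUnion ω m n⟩ : Step N ω m n →L[ℂ] UnionSpace N ω m)))

/-- The inductive topology, transported to the target, competes in the infimum because `τ_m`-bounded
sets are bounded in the union. -/
theorem continuous_unionEquivBorn_symm {ω : ℝ≥0 → ℝ≥0} (hω : IsWeight ω) (m : ℕ+) :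
    Continuous (unionEquivBorn N hω m).symm := by
  refine continuous_iff_le_induced.2 (sInf_le
    ⟨(isLC_unionTopology ω m).induced (unionEquivBorn N hω m).symm.toLinearMap, fun B hB => ?_⟩)
  have hB' : unionEquivMult N hω m '' ((unionEquivMult N hω m).symm '' B) = B := by
    rw [← Set.image_comp]
    simp
  have h : Bornology.IsVonNBounded ℂ ((unionEquivMult N hω m).symm '' B) :=
    isVonNBounded_of_image_unionEquivMult hω m _ (hB'.symm ▸ hB)
  let _ : TopologicalSpace (Bornologification (MultSpace N ω m)) :=
    (unionTopology ω m).induced (unionEquivBorn N hω m).symm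
  have hc : Continuous (unionEquivBorn N hω m) := by
    refine continuous_induced_rng.2 ?_
    have : (unionEquivBorn N hω m).symm ∘ unionEquivBorn N hω m = id := by
      funext f
      simp
    rw [this]
    exact continuous_id
  have h' := h.image (⟨(unionEquivBorn N hω m).toLinearMap, hc⟩ :
    UnionSpace N ω m →L[ℂ] Bornologification (MultSpace N ω m))
  exact hB' ▸ h'

/-! ### Commutation of partial derivatives -/

theorem pderiv_pderiv_apply {f : EuclideanSpace ℝ (Fin N) → ℂ} (hf : ContDiff ℝ (⊤ : ℕ∞) f)
    (i j : Fin N) (x : EuclideanSpace ℝ (Fin N)) :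
    pderiv i (pderiv j f) x =
      fderiv ℝ (fderiv ℝ f) x (EuclideanSpace.single i 1) (EuclideanSpace.single j 1) := by
  have h : DifferentiableAt ℝ (fderiv ℝ f) x :=
    ((contDiff_infty_iff_fderiv.1 hf).2.differentiable (by simp)) x
  change fderiv ℝ (fun y => fderiv ℝ f y (EuclideanSpace.single j 1)) x _ = _
  rw [fderiv_clm_apply h (differentiableAt_const _)]
  simp

theorem pderiv_comm {f : EuclideanSpace ℝ (Fin N) → ℂ} (hf : ContDiff ℝ (⊤ : ℕ∞) f)
    (i j : Fin N) : pderiv i (pderiv j f) = pderiv j (pderiv i f) := by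
  funext x
  rw [pderiv_pderiv_apply hf, pderiv_pderiv_apply hf]
  exact (hf.contDiffAt.isSymmSndFDerivAt (by
    rw [minSmoothness_of_isRCLikeNormedField]
    exact WithTop.coe_le_coe.2 (le_top : (2 : ℕ∞) ≤ ⊤))).eq _ _

theorem pderiv_iterate_comm {f : EuclideanSpace ℝ (Fin N) → ℂ} (hf : ContDiff ℝ (⊤ : ℕ∞) f)
    (i j : Fin N) (k : ℕ) : pderiv i ((pderiv j)^[k] f) = (pderiv j)^[k] (pderiv i f) := by
  induction k with
  | zero => rfl
  | succ k ih =>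
    rw [Function.iterate_succ_apply', Function.iterate_succ_apply',
      pderiv_comm (((smoothLin_pderiv j).iterate k).smooth f hf), ih]

theorem smoothLin_foldr_pderiv (α : Fin N → ℕ) (l : List (Fin N)) :
    SmoothLin (fun f : EuclideanSpace ℝ (Fin N) → ℂ =>
      l.foldr (fun i h => (pderiv i)^[α i] h) f) := by
  induction l with
  | nil => exact SmoothLin.id
  | cons i l ih =>
    simp only [List.foldr_cons]
    exact ((smoothLin_pderiv i).iterate (α i)).comp ih

/-- `mderiv` applies the coordinates in a fixed order; `pderiv i` commutes past the other blocks
until it joins the block of `i`, unique by `Nodup`. -/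
theorem pderiv_foldr_pderiv {f : EuclideanSpace ℝ (Fin N) → ℂ} (hf : ContDiff ℝ (⊤ : ℕ∞) f)
    (α : Fin N → ℕ) (i : Fin N) (l : List (Fin N)) (hl : l.Nodup) (hi : i ∈ l) :
    pderiv i (l.foldr (fun i h => (pderiv i)^[α i] h) f) =
      l.foldr (fun j h => (pderiv j)^[(α + Pi.single i 1 : Fin N → ℕ) j] h) f := by
  induction l with
  | nil => simp at hi
  | cons j l ih =>
    rw [List.nodup_cons] at hl
    rw [List.foldr_cons, List.foldr_cons]
    by_cases hij : i = j
    · subst hij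
      have hcongr : l.foldr (fun j h => (pderiv j)^[(α + Pi.single i 1 : Fin N → ℕ) j] h) f =
          l.foldr (fun j h => (pderiv j)^[α j] h) f := by
        refine List.foldr_ext _ _ _ fun k hk h => ?_
        have hki : k ≠ i := fun h => hl.1 (h ▸ hk)
        simp [hki]
      rw [hcongr, ← Function.iterate_succ_apply' (pderiv i)]
      simp
    · rw [pderiv_iterate_comm ((smoothLin_foldr_pderiv α l).smooth f hf),
        ih hl.2 ((List.mem_cons.1 hi).resolve_left hij)]
      have hji : j ≠ i := fun h => hij h.symm
      simp [hji]

theorem pderiv_mderiv {f : EuclideanSpace ℝ (Fin N) → ℂ} (hf : ContDiff ℝ (⊤ : ℕ∞) f)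
    (α : Fin N → ℕ) (i : Fin N) : pderiv i (mderiv α f) = mderiv (α + Pi.single i 1) f :=
  pderiv_foldr_pderiv hf α i _ (List.nodup_finRange N) (List.mem_finRange i)

theorem mderiv_sub {f g : EuclideanSpace ℝ (Fin N) → ℂ} (hf : ContDiff ℝ (⊤ : ℕ∞) f)
    (hg : ContDiff ℝ (⊤ : ℕ∞) g) (α : Fin N → ℕ) :
    mderiv α (f - g) = mderiv α f - mderiv α g := by
  have h : f - g = f + (-1 : ℂ) • g := by simp [sub_eq_add_neg]
  rw [h, (smoothLin_mderiv α).add f _ hf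
    (show ContDiff ℝ (⊤ : ℕ∞) ((-1 : ℂ) • g) from hg.const_smul (-1 : ℂ)),
    (smoothLin_mderiv α).smul _ g hg]
  simp [sub_eq_add_neg]

/-! ### Families of functions closed under partial derivatives -/

/-- The derivative with prescribed partial derivatives `c i`. -/
def partialsToCLM (c : Fin N → ℂ) : EuclideanSpace ℝ (Fin N) →L[ℝ] ℂ :=
  ∑ i, (EuclideanSpace.proj i : EuclideanSpace ℝ (Fin N) →L[ℝ] ℝ).smulRight (c i)

theorem partialsToCLM_single (c : Fin N → ℂ) (i : Fin N) :
    partialsToCLM c (EuclideanSpace.single i 1) = c i := by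
  simp [partialsToCLM]

theorem fderiv_eq_partialsToCLM (f : EuclideanSpace ℝ (Fin N) → ℂ)
    (x : EuclideanSpace ℝ (Fin N)) :
    fderiv ℝ f x = partialsToCLM fun i => pderiv i f x := by
  refine ContinuousLinearMap.coe_injective
    ((EuclideanSpace.basisFun (Fin N) ℝ).toBasis.ext fun i => ?_)
  simp [partialsToCLM_single, pderiv]

theorem norm_partialsToCLM_sub_le (c d : Fin N → ℂ) :
    ‖partialsToCLM c - partialsToCLM d‖ ≤ ∑ i, ‖c i - d i‖ := by
  have h : partialsToCLM c - partialsToCLM d = partialsToCLM (c - d) := by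
    refine ContinuousLinearMap.coe_injective
      ((EuclideanSpace.basisFun (Fin N) ℝ).toBasis.ext fun i => ?_)
    simp [partialsToCLM_single]
  rw [h, partialsToCLM]
  refine (norm_sum_le _ _).trans (Finset.sum_le_sum fun i _ => ?_)
  rw [ContinuousLinearMap.norm_smulRight_apply]
  refine mul_le_of_le_one_left (norm_nonneg _)
    (ContinuousLinearMap.opNorm_le_bound _ zero_le_one fun x => ?_)
  rw [one_mul]
  exact PiLp.norm_apply_le x i

/-- The derivative of each member is assembled from members of the family, so `C^k` for all indices
at once gives `C^{k+1}`. -/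
theorem contDiff_of_hasFDerivAt_family {F : (Fin N → ℕ) → EuclideanSpace ℝ (Fin N) → ℂ}
    (hF : ∀ α x, HasFDerivAt (F α) (partialsToCLM fun i => F (α + Pi.single i 1) x) x)
    (α : Fin N → ℕ) : ContDiff ℝ (⊤ : ℕ∞) (F α) := by
  rw [contDiff_infty]
  intro k
  induction k generalizing α with
  | zero =>
    exact contDiff_zero.2 (continuous_iff_continuousAt.2 fun x => (hF α x).continuousAt)
  | succ k ih =>
    refine contDiff_succ_iff_hasFDerivAt.2 ⟨_, ?_, hF α⟩
    exact ContDiff.sum fun i _ => contDiff_const.smulRight (ih _)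

theorem mderiv_of_hasFDerivAt_family {F : (Fin N → ℕ) → EuclideanSpace ℝ (Fin N) → ℂ}
    (hF : ∀ α x, HasFDerivAt (F α) (partialsToCLM fun i => F (α + Pi.single i 1) x) x)
    (α : Fin N → ℕ) : mderiv α (F 0) = F α := by
  have h1 : ∀ β i, pderiv i (F β) = F (β + Pi.single i 1) := fun β i => by
    funext x
    rw [pderiv, (hF β x).fderiv, partialsToCLM_single]
  have h2 : ∀ (k : ℕ) β i, (pderiv i)^[k] (F β) = F (β + Pi.single i k) := fun k β i => by
    induction k with
    | zero => simp
    | succ k ih => rw [Function.iterate_succ_apply', ih, h1, add_assoc, ← Pi.single_add]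
  have h3 : ∀ l : List (Fin N), l.foldr (fun i h => (pderiv i)^[α i] h) (F 0) =
      F ((l.map fun i => Pi.single i (α i)).sum) := fun l => by
    induction l with
    | nil => rfl
    | cons i l ih => rw [List.foldr_cons, ih, h2, List.map_cons, List.sum_cons, add_comm]
  rw [mderiv, h3]
  congr 1
  rw [← List.ofFn_eq_map, List.sum_ofFn, Finset.univ_sum_single]

theorem tendstoUniformlyOn_partialsToCLM {u : ℕ → Fin N → EuclideanSpace ℝ (Fin N) → ℂ}
    {v : Fin N → EuclideanSpace ℝ (Fin N) → ℂ} {s : Set (EuclideanSpace ℝ (Fin N))}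
    (h : ∀ i, TendstoUniformlyOn (fun j => u j i) (v i) atTop s) :
    TendstoUniformlyOn (fun j y => partialsToCLM fun i => u j i y)
      (fun y => partialsToCLM fun i => v i y) atTop s := by
  refine Metric.tendstoUniformlyOn_iff.2 fun ε hε => ?_
  -- Dividing by `N + 1` keeps the final inequality strict and allows `N = 0`.
  have hev : ∀ i : Fin N, ∀ᶠ j in atTop, ∀ y ∈ s, dist (v i y) (u j i y) < ε / (N + 1) :=
    fun i => Metric.tendstoUniformlyOn_iff.1 (h i) _ (by positivity)
  filter_upwards [eventually_all.2 hev] with j hj y hy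
  rw [dist_eq_norm]
  calc _ ≤ ∑ i : Fin N, ‖v i y - u j i y‖ := norm_partialsToCLM_sub_le _ _
    _ ≤ ∑ _i : Fin N, ε / (N + 1) := Finset.sum_le_sum fun i _ => by
        rw [← dist_eq_norm]
        exact (hj i y hy).le
    _ = N * (ε / (N + 1)) := by simp
    _ < ε := by
        rw [← mul_div_assoc, div_lt_iff₀ (by positivity)]
        linarith

theorem hasFDerivAt_mderiv {f : EuclideanSpace ℝ (Fin N) → ℂ} (hf : ContDiff ℝ (⊤ : ℕ∞) f)
    (α : Fin N → ℕ) (x : EuclideanSpace ℝ (Fin N)) :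
    HasFDerivAt (mderiv α f) (partialsToCLM fun i => mderiv (α + Pi.single i 1) f x) x := by
  have hs : ContDiff ℝ (⊤ : ℕ∞) (mderiv α f) := (smoothLin_mderiv α).smooth f hf
  have h : HasFDerivAt (mderiv α f) (fderiv ℝ (mderiv α f) x) x :=
    (hs.differentiable (by simp) x).hasFDerivAt
  rw [fderiv_eq_partialsToCLM] at h
  simp_rw [pderiv_mderiv hf] at h
  exact h

theorem hasFDerivAt_of_uniformCauchySeqOn {u : ℕ → EuclideanSpace ℝ (Fin N) → ℂ}
    (hu : ∀ j, ContDiff ℝ (⊤ : ℕ∞) (u j))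
    {F : (Fin N → ℕ) → EuclideanSpace ℝ (Fin N) → ℂ}
    (hF : ∀ α x, Tendsto (fun j => mderiv α (u j) x) atTop (𝓝 (F α x)))
    (hc : ∀ α (R : ℝ), UniformCauchySeqOn (fun j => mderiv α (u j)) atTop (Metric.ball 0 R))
    (α : Fin N → ℕ) (x : EuclideanSpace ℝ (Fin N)) :
    HasFDerivAt (F α) (partialsToCLM fun i => F (α + Pi.single i 1) x) x := by
  have hx : x ∈ Metric.ball (0 : EuclideanSpace ℝ (Fin N)) (‖x‖ + 1) := by simp
  have hunif : TendstoUniformlyOn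
      (fun j y => partialsToCLM fun i => mderiv (α + Pi.single i 1) (u j) y)
      (fun y => partialsToCLM fun i => F (α + Pi.single i 1) y) atTop
      (Metric.ball 0 (‖x‖ + 1)) :=
    tendstoUniformlyOn_partialsToCLM (u := fun j i => mderiv (α + Pi.single i 1) (u j))
      (v := fun i => F (α + Pi.single i 1))
      fun i => (hc _ _).tendstoUniformlyOn_of_tendsto fun y _ => hF _ y
  exact hasFDerivAt_of_tendstoLocallyUniformlyOn Metric.isOpen_ball
    hunif.tendstoLocallyUniformlyOn (fun j y _ => hasFDerivAt_mderiv (hu j) α y)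
    (fun y _ => hF α y) hx

/-! ### Completeness of the steps -/

theorem Step.norm_mderiv_sub_mul_le {ω : ℝ≥0 → ℝ≥0} {m n : ℕ+} (f g : Step N ω m n)
    (α : Fin N → ℕ) (x : EuclideanSpace ℝ (Fin N)) :
    ‖mderiv α f.fn x - mderiv α g.fn x‖ * (stepWeight ω m n α x).toReal ≤ dist f g := by
  have h := (f - g).norm_mderiv_mul_le α x
  have hfn : (f - g).fn = f.fn - g.fn := rfl
  rw [hfn, mderiv_sub f.contDiff g.contDiff] at h
  rw [dist_eq_norm]
  exact h

theorem IsWeight.completeSpace_step {ω : ℝ≥0 → ℝ≥0} (hω : IsWeight ω)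
    (hfin : ∀ s : ℝ, 0 ≤ s → youngConj ω s < ⊤) (m n : ℕ+) :
    CompleteSpace (Step N ω m n) := by
  refine Metric.complete_of_cauchySeq_tendsto fun u hu => ?_
  -- Finiteness of `φ*` enters here: it keeps the weight of every order bounded below on balls.
  have hball : ∀ (α : Fin N → ℕ) (R : ℝ), ∃ c : ℝ, 0 < c ∧
      ∀ x ∈ Metric.ball (0 : EuclideanSpace ℝ (Fin N)) R,
        c ≤ (stepWeight ω m n α x).toReal := fun α R => by
    refine ⟨Real.exp (-((n : ℕ) : ℝ) * ω R.toNNReal) * (derivFactor ω m (mlen α)).toReal,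
      mul_pos (Real.exp_pos _) (ENNReal.toReal_pos
        (derivFactor_pos (hfin _ (by positivity))).ne' (derivFactor_lt_top ω m _).ne),
      fun x hx => ?_⟩
    rw [stepWeight_toReal, neg_mul, neg_mul]
    gcongr
    refine hω.mono (NNReal.le_toNNReal_of_coe_le ?_)
    rw [mem_ball_zero_iff] at hx
    exact hx.le
  have hc : ∀ α (R : ℝ),
      UniformCauchySeqOn (fun j => mderiv α (u j).fn) atTop (Metric.ball 0 R) := fun α R => by
    obtain ⟨c, hc0, hc⟩ := hball α R
    refine Metric.uniformCauchySeqOn_iff.2 fun ε hε => ?_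
    obtain ⟨J, hJ⟩ := Metric.cauchySeq_iff.1 hu (ε * c) (by positivity)
    refine ⟨J, fun j hj k hk x hx => ?_⟩
    have h1 := ((u j).norm_mderiv_sub_mul_le (u k) α x).trans_lt (hJ j hj k hk)
    rw [dist_eq_norm]
    exact lt_of_mul_lt_mul_right
      ((mul_le_mul_of_nonneg_left (hc x hx) (norm_nonneg _)).trans_lt h1) hc0.le
  have hlim : ∀ α x, ∃ y, Tendsto (fun j => mderiv α (u j).fn x) atTop (𝓝 y) := fun α x =>
    cauchySeq_tendsto_of_complete ((hc α (‖x‖ + 1)).cauchySeq (by simp))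
  choose F hF using hlim
  have hder := hasFDerivAt_of_uniformCauchySeqOn (fun j => (u j).contDiff) hF hc
  have hsm := contDiff_of_hasFDerivAt_family hder
  have hmd := mderiv_of_hasFDerivAt_family hder
  -- Let `k → ∞` in the Cauchy estimate at fixed `α` and `x`. The bound is uniform in both, and
  -- yields membership of the limit as well as convergence in norm.
  have hle : ∀ ε > 0, ∃ J, ∀ j ≥ J,
      wsup (stepWeight ω m n) ((u j).fn - F 0) ≤ ENNReal.ofReal ε := fun ε hε => by
    obtain ⟨J, hJ⟩ := Metric.cauchySeq_iff.1 hu ε hε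
    refine ⟨J, fun j hj => iSup₂_le fun α x => ?_⟩
    rw [mderiv_sub (u j).contDiff (hsm 0), hmd, Pi.sub_apply, ← ofReal_norm,
      ← ENNReal.ofReal_toReal (stepWeight_lt_top ω m n α x).ne,
      ← ENNReal.ofReal_mul (norm_nonneg _)]
    refine ENNReal.ofReal_le_ofReal (le_of_tendsto
      (((tendsto_const_nhds.sub (hF α x)).norm).mul_const _) ?_)
    filter_upwards [eventually_ge_atTop J] with k hk
    exact ((u j).norm_mderiv_sub_mul_le (u k) α x).trans (hJ j hj k hk).le
  obtain ⟨J, hJ⟩ := hle 1 one_pos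
  have hmem : F 0 ∈ stepSub N ω m n := by
    have h1 : (u J).fn - F 0 ∈ stepSub N ω m n :=
      ⟨(u J).contDiff.sub (hsm 0), fun _ => (hJ J le_rfl).trans_lt ENNReal.ofReal_lt_top⟩
    simpa using (stepSub N ω m n).sub_mem (u J).mem h1
  obtain ⟨G, hG⟩ : ∃ G : Step N ω m n, G.fn = F 0 :=
    ⟨(⟨F 0, hmem⟩ : stepSub N ω m n), rfl⟩
  refine ⟨G, Metric.tendsto_atTop.2 fun ε hε => ?_⟩
  obtain ⟨J, hJ⟩ := hle (ε / 2) (half_pos hε)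
  refine ⟨J, fun j hj => lt_of_le_of_lt ?_ (half_lt_self hε)⟩
  have hfn : (u j - G).fn = (u j).fn - F 0 := hG ▸ rfl
  rw [dist_eq_norm, Step.norm_def, hfn]
  exact ENNReal.toReal_le_of_le_ofReal (half_pos hε).le (hJ j hj)

end OmegaMult

end

open OmegaMult in
theorem proposition5p5 (N : ℕ) (ω : NNReal → NNReal) (hω : IsWeight ω) (m : ℕ+) :
    -- the steps are normed spaces, Banach spaces if the Young conjugate is finite-valued,
    -- and form an inductive spectrum with Hausdorff limit
    (∀ n : ℕ+, T2Space (Step N ω m n)) ∧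
    ((∀ s : ℝ, 0 ≤ s → youngConj ω s < ⊤) → ∀ n : ℕ+, CompleteSpace (Step N ω m n)) ∧
    (∀ (n n' : ℕ+) (h : n ≤ n'), Continuous (stepToStep N ω m h)) ∧
    T2Space (UnionSpace N ω m) ∧
    -- regularity
    (∀ B : Set (UnionSpace N ω m), Bornology.IsVonNBounded ℂ B →
      ∃ (n : ℕ+) (A : Set (Step N ω m n)),
        Bornology.IsBounded A ∧ stepToUnion N ω m n '' A = B) ∧
    -- the associated bornological space
    (∃ e : UnionSpace N ω m ≃L[ℂ] Bornologification (MultSpace N ω m),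
      ∀ f : UnionSpace N ω m, (e f).out.fn = f.fn) := by
  refine ⟨fun n => t2Space_step N ω m n, fun h n => hω.completeSpace_step h m n,
    fun _ _ h => continuous_stepToStep ω m h, t2Space_unionSpace N ω m,
    fun B hB => exists_step_of_isVonNBounded hω m B (isVonNBounded_image_unionEquivMult hω m hB),
    ⟨{ unionEquivBorn N hω m with
        continuous_toFun := continuous_unionEquivBorn hω m
        continuous_invFun := continuous_unionEquivBorn_symm hω m }, fun _ => rfl⟩⟩
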